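/- Let $\Bbbk$ be a field and let $Q=(Q_0,Q_1,s,t)$ be a finite quiver whose underlying graph is connected (and non-empty). Let $\mathcal I$ be a two-sided ideal of the path algebra $\Bbbk Q$ (in which $pq$ is the concatenation of $p$ and $q$ if $t(p)=s(q)$, and $0$ otherwise), generated by a set of paths of length $2$. Assume that every vertex is the source of at most two arrows and the target of at most two arrows; that whenever $s(\alpha)=t(\beta)=t(\beta')$ for arrows with $\beta\ne\beta'$, exactly one of $\beta\alpha,\beta'\alpha$ is in $\mathcal I$; and that whenever $t(\alpha)=s(\beta)=s(\beta')$ for arrows with $\beta\neq\beta'$, exactly one of $\alpha\beta,\alpha\beta'$ is in $\mathcal I$. The algebra $A=\Bbbk Q/\mathcal I$, graded by path length, is called *gentle* if it is finite dimensional and *locally gentle* if it is infinite dimensional. A *finite maximal path* of $A$ is a path $p\notin\mathcal I$ such that $p\alpha\in\mathcal I$ and $\alpha p\in\mathcal I$ for every arrow $\alpha$. A *cycle in $A$* is a closed path of positive length not in $\mathcal I$; it is *primitive* if it is not $(c')^n$ for a cycle $c'$ in $A$ and some $n>1$. $A$ *has an infinite maximal path* (the periodic word $c^\infty$) if there is a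 primitive cycle $c$ in $A$ with $c^2\notin\mathcal I$. Let $S=A/J$, where $J$ is the graded Jacobson radical of $A$, i.e. the intersection of its maximal homogeneous right ideals. In the category of $\mathbb Z$-graded right $A$-modules with degree-preserving $A$-linear maps, where $M[d]_i=M_{i+d}$, put $\underline{\mathrm{Ext}}^i_A(M,N)=\bigoplus_{d\in\mathbb Z}\mathrm{Ext}^i(M,N[d])$, and let $\mathrm{depth}(A)=\min\{i\ge 0:\underline{\mathrm{Ext}}^i_A(S,A)\neq 0\}$. For a finite dimensional subspace $V$ that generates $A$ as a unital $\Bbbk$-algebra, let $V^{n}$ be the span of all products of at most $n$ elements of $V$ (including the empty product $1$); $\mathrm{GKdim}(A)=d$ means that such a $V$ exists and $\limsup_{n\to\infty}\log(\dim_\Bbbk V^n)/\log n=d$ for every such $V$. Then: 1. $\mathrm{depth}(A)=0$ if and only if $A$ has a finite maximal path, and $\mathrm{depth}(A)=1$ if $A$ has no finite maximal path. 2. $A$ is locally gentle if and only if it has an infinite maximal path. If $A$ is locally gentle, then $\mathrm{GKdim}(A)=1$; if $A$ is gentle, then $\mathrm{GKdim}(A)=0$. -/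

import Mathlib

open CategoryTheory CategoryTheory.Limits

universe u v w

noncomputable section

/-- An elementwise criterion for an internal direct sum of subgroups. -/
theorem isInternal_addSubgroup_iff {ι : Type v} [DecidableEq ι] {M : Type w} [AddCommGroup M]
    (N : ι → AddSubgroup M) :
    DirectSum.IsInternal N ↔
      (∀ (s : Finset ι) (x : ι → M), (∀ i, x i ∈ N i) → ∑ i ∈ s, x i = 0 → ∀ i ∈ s, x i = 0) ∧
      ∀ m : M, ∃ (s : Finset ι) (x : ι → M), (∀ i, x i ∈ N i) ∧ ∑ i ∈ s, x i = m := by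
  classical
  constructor
  · rintro ⟨hi, hs⟩
    refine ⟨fun s x hx h0 i his => ?_, fun m => ?_⟩
    · have key : (∑ j ∈ s, DirectSum.of (fun j => N j) j ⟨x j, hx j⟩) = 0 := by
        apply hi
        rw [map_sum, map_zero]
        simpa using h0
      have := congrArg (fun z => (z i : M)) key
      simp only [DirectSum.zero_apply, ZeroMemClass.coe_zero] at this
      rw [← this, DFinsupp.finsetSum_apply, AddSubmonoidClass.coe_finsetSum,
        Finset.sum_eq_single i]
      · rw [DirectSum.of_eq_same]
      · intro j _ hj
        rw [DirectSum.of_eq_of_ne _ _ _ (Ne.symm hj)]; rfl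
      · intro h; exact absurd his h
    · obtain ⟨y, rfl⟩ := hs m
      refine ⟨DFinsupp.support y, fun i => y i, fun i => (y i).2, ?_⟩
      rw [DirectSum.coeAddMonoidHom_eq_dfinsuppSum]; rfl
  · rintro ⟨hi, hs⟩
    refine ⟨?_, fun m => ?_⟩
    · rw [injective_iff_map_eq_zero]
      intro y hy
      rw [DirectSum.coeAddMonoidHom_eq_dfinsuppSum] at hy
      have := hi (DFinsupp.support y) (fun i => y i) (fun i => (y i).2) hy
      refine DFinsupp.ext fun i => ?_
      by_cases h : i ∈ DFinsupp.support y
      · exact Subtype.ext (this i h)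
      · simpa using h
    · obtain ⟨s, x, hx, rfl⟩ := hs m
      refine ⟨∑ j ∈ s, DirectSum.of (fun j => N j) j ⟨x j, hx j⟩, ?_⟩
      rw [map_sum]; simp

/-- A `ℤ`-graded right module `M = ⨁ i, M i` over a `k`-algebra `A` with homogeneous
parts `𝒜 n`, `n : ℕ`. Right `A`-modules are modules over `Aᵐᵒᵖ`. -/
structure GrModR {k : Type v} [Field k] {A : Type u} [Ring A] [Algebra k A]
    (𝒜 : ℕ → Submodule k A) : Type (max u (w + 1)) where
  carrier : Type w
  [addCommGroup : AddCommGroup carrier]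
  [module : Module Aᵐᵒᵖ carrier]
  /-- the homogeneous part of degree `i` -/
  deg : ℤ → AddSubgroup carrier
  isInternal : DirectSum.IsInternal deg
  smul_mem : ∀ (i : ℤ) (n : ℕ) (a : A) (m : carrier), a ∈ 𝒜 n → m ∈ deg i →
    MulOpposite.op a • m ∈ deg (i + n)

namespace GrModR

variable {k : Type v} [Field k] {A : Type u} [Ring A] [Algebra k A] {𝒜 : ℕ → Submodule k A}

attribute [instance] GrModR.addCommGroup GrModR.module

/-- Homomorphisms of graded right modules: `A`-linear maps that preserve degrees. -/
@[ext]
structure Hom (M N : GrModR.{u, v, w} 𝒜) : Type w where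
  toLin : M.carrier →ₗ[Aᵐᵒᵖ] N.carrier
  map_deg : ∀ (i : ℤ) (x : M.carrier), x ∈ M.deg i → toLin x ∈ N.deg i

instance : Category (GrModR.{u, v, w} 𝒜) where
  Hom := Hom
  id M := ⟨LinearMap.id, fun _ _ h => h⟩
  comp f g := ⟨g.toLin ∘ₗ f.toLin, fun i x h => g.map_deg i _ (f.map_deg i x h)⟩

variable {M N P : GrModR.{u, v, w} 𝒜}

/-- The linear map underlying a morphism. -/
def lin (f : M ⟶ N) : M.carrier →ₗ[Aᵐᵒᵖ] N.carrier := Hom.toLin f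

theorem lin_deg (f : M ⟶ N) {i : ℤ} {x : M.carrier} (h : x ∈ M.deg i) : lin f x ∈ N.deg i :=
  Hom.map_deg f i x h

/-- The morphism given by a degree preserving linear map. -/
def ofLin (f : M.carrier →ₗ[Aᵐᵒᵖ] N.carrier)
    (h : ∀ (i : ℤ) (x : M.carrier), x ∈ M.deg i → f x ∈ N.deg i) : M ⟶ N := Hom.mk f h

@[simp] theorem lin_ofLin (f : M.carrier →ₗ[Aᵐᵒᵖ] N.carrier) (h) :
    lin (ofLin (M := M) (N := N) f h) = f := rfl

@[simp] theorem lin_id : lin (𝟙 M) = LinearMap.id := rfl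

@[simp] theorem lin_comp (f : M ⟶ N) (g : N ⟶ P) : lin (f ≫ g) = lin g ∘ₗ lin f := rfl

theorem lin_injective : Function.Injective (lin : (M ⟶ N) → _) := fun _ _ h => Hom.ext h

theorem hom_ext {f g : M ⟶ N} (h : ∀ x, lin f x = lin g x) : f = g :=
  lin_injective (LinearMap.ext h)

instance : Zero (M ⟶ N) := ⟨ofLin 0 fun i _ _ => (N.deg i).zero_mem⟩
instance : Add (M ⟶ N) :=
  ⟨fun f g => ofLin (lin f + lin g) fun i _ h => (N.deg i).add_mem (lin_deg f h) (lin_deg g h)⟩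
instance : Neg (M ⟶ N) := ⟨fun f => ofLin (-lin f) fun i _ h => (N.deg i).neg_mem (lin_deg f h)⟩
instance : Sub (M ⟶ N) :=
  ⟨fun f g => ofLin (lin f - lin g) fun i _ h => (N.deg i).sub_mem (lin_deg f h) (lin_deg g h)⟩
instance : SMul ℕ (M ⟶ N) :=
  ⟨fun n f => ofLin (n • lin f) fun i _ h => (N.deg i).nsmul_mem (lin_deg f h) n⟩
instance : SMul ℤ (M ⟶ N) :=
  ⟨fun n f => ofLin (n • lin f) fun i _ h => (N.deg i).zsmul_mem (lin_deg f h) n⟩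

instance : AddCommGroup (M ⟶ N) :=
  Function.Injective.addCommGroup lin lin_injective rfl (fun _ _ => rfl) (fun _ => rfl)
    (fun _ _ => rfl) (fun _ _ => rfl) (fun _ _ => rfl)

@[simp] theorem lin_zero : lin (0 : M ⟶ N) = 0 := rfl
@[simp] theorem lin_add (f g : M ⟶ N) : lin (f + g) = lin f + lin g := rfl

instance : Preadditive (GrModR.{u, v, w} 𝒜) where
  add_comp _ _ _ f f' g := lin_injective (LinearMap.comp_add _ _ _)
  comp_add _ _ _ f g g' := lin_injective (LinearMap.add_comp _ _ _)

theorem exists_sum (m : M.carrier) :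
    ∃ (s : Finset ℤ) (x : ℤ → M.carrier), (∀ i, x i ∈ M.deg i) ∧ ∑ i ∈ s, x i = m :=
  ((isInternal_addSubgroup_iff _).1 M.isInternal).2 m

theorem eq_zero_of_sum (s : Finset ℤ) (x : ℤ → M.carrier) (hx : ∀ i, x i ∈ M.deg i)
    (h : ∑ i ∈ s, x i = 0) : ∀ i ∈ s, x i = 0 :=
  ((isInternal_addSubgroup_iff _).1 M.isInternal).1 s x hx h

/-- A homogeneous element that is a sum of homogeneous elements is its own component. -/
theorem eq_of_sum (s : Finset ℤ) (x : ℤ → M.carrier) (hx : ∀ i, x i ∈ M.deg i) {j : ℤ}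
    {m : M.carrier} (hm : m ∈ M.deg j) (h : ∑ i ∈ s, x i = m) :
    (∀ i ∈ s, i ≠ j → x i = 0) ∧ (j ∈ s → x j = m) ∧ (j ∉ s → m = 0) := by
  classical
  have key := M.eq_zero_of_sum (insert j s)
    (fun i => (if i ∈ s then x i else 0) - (if i = j then m else 0)) (fun i => ?_) ?_
  · refine ⟨fun i hi hij => ?_, fun hj => ?_, fun hj => ?_⟩
    · simpa [hi, hij] using key i (Finset.mem_insert_of_mem hi)
    · simpa [hj, sub_eq_zero] using key j (Finset.mem_insert_self _ _)
    · simpa [hj] using key j (Finset.mem_insert_self _ _)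
  · refine (M.deg i).sub_mem ?_ ?_
    · split_ifs
      exacts [hx i, (M.deg i).zero_mem]
    · split_ifs with hij
      · exact hij ▸ hm
      · exact (M.deg i).zero_mem
  · rw [Finset.sum_sub_distrib, Finset.sum_ite_eq' (insert j s) j, if_pos (by simp), ← h,
      sub_eq_zero, ← Finset.sum_subset (Finset.subset_insert j s)]
    · exact Finset.sum_congr rfl fun i hi => by simp [hi]
    · intro i _ hi; simp [hi]

/-- A graded right submodule with the induced grading. -/
def sub (M : GrModR.{u, v, w} 𝒜) (Q : Submodule Aᵐᵒᵖ M.carrier)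
    (hQ : ∀ (s : Finset ℤ) (x : ℤ → M.carrier), (∀ i, x i ∈ M.deg i) → ∑ i ∈ s, x i ∈ Q →
      ∀ i ∈ s, x i ∈ Q) : GrModR.{u, v, w} 𝒜 where
  carrier := Q
  deg i := (M.deg i).comap Q.subtype.toAddMonoidHom
  isInternal := by
    classical
    rw [isInternal_addSubgroup_iff]
    refine ⟨fun s x hx h i hi => ?_, fun m => ?_⟩
    · refine Subtype.ext (M.eq_zero_of_sum s (fun i => (x i : M.carrier)) hx ?_ i hi)
      simpa using congrArg (Subtype.val) h
    · obtain ⟨s, x, hx, h⟩ := M.exists_sum m.1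
      have hmem := hQ s x hx (h ▸ m.2)
      refine ⟨s, fun i => if hi : i ∈ s then ⟨x i, hmem i hi⟩ else 0, fun i => ?_, ?_⟩
      · by_cases hi : i ∈ s
        · simpa [hi] using hx i
        · simp [hi]
      · refine Subtype.ext ?_
        rw [← h, AddSubmonoidClass.coe_finsetSum]
        exact Finset.sum_congr rfl fun i hi => by simp [hi]
  smul_mem i n a m ha hm := M.smul_mem i n a m ha hm

/-- The quotient of a graded right module by a graded submodule, with the induced grading. -/
def quot (M : GrModR.{u, v, w} 𝒜) (Q : Submodule Aᵐᵒᵖ M.carrier)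
    (hQ : ∀ (s : Finset ℤ) (x : ℤ → M.carrier), (∀ i, x i ∈ M.deg i) → ∑ i ∈ s, x i ∈ Q →
      ∀ i ∈ s, x i ∈ Q) : GrModR.{u, v, w} 𝒜 where
  carrier := M.carrier ⧸ Q
  deg i := (M.deg i).map Q.mkQ.toAddMonoidHom
  isInternal := by
    rw [isInternal_addSubgroup_iff]
    refine ⟨fun s x hx h i hi => ?_, fun m => ?_⟩
    · choose y hy hyx using hx
      obtain rfl : x = fun i => Q.mkQ (y i) := funext fun i => (hyx i).symm
      rw [← map_sum] at h
      exact (Submodule.Quotient.mk_eq_zero Q).2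
        (hQ s y hy ((Submodule.Quotient.mk_eq_zero Q).1 h) i hi)
    · obtain ⟨m, rfl⟩ := Q.mkQ_surjective m
      obtain ⟨s, x, hx, h⟩ := M.exists_sum m
      exact ⟨s, fun i => Q.mkQ (x i), fun i => ⟨x i, hx i, rfl⟩, by rw [← h, map_sum]⟩
  smul_mem := by
    rintro i n a _ ha ⟨m, hm, rfl⟩
    exact ⟨MulOpposite.op a • m, M.smul_mem i n a m ha hm, rfl⟩

theorem ker_homogeneous (f : M ⟶ N) (s : Finset ℤ) (x : ℤ → M.carrier)
    (hx : ∀ i, x i ∈ M.deg i) (h : ∑ i ∈ s, x i ∈ LinearMap.ker (lin f)) :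
    ∀ i ∈ s, x i ∈ LinearMap.ker (lin f) := by
  rw [LinearMap.mem_ker, map_sum] at h
  exact N.eq_zero_of_sum s (fun i => lin f (x i)) (fun i => lin_deg f (hx i)) h

theorem range_homogeneous (f : M ⟶ N) (s : Finset ℤ) (x : ℤ → N.carrier)
    (hx : ∀ i, x i ∈ N.deg i) (h : ∑ i ∈ s, x i ∈ LinearMap.range (lin f)) :
    ∀ i ∈ s, x i ∈ LinearMap.range (lin f) := by
  classical
  obtain ⟨m, hm⟩ := h
  obtain ⟨t, y, hy, rfl⟩ := M.exists_sum m
  rw [map_sum] at hm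
  have key := N.eq_zero_of_sum (s ∪ t)
    (fun i => (if i ∈ s then x i else 0) - lin f (if i ∈ t then y i else 0)) (fun i => ?_) ?_
  · intro i hi
    have := key i (Finset.mem_union_left _ hi)
    rw [if_pos hi, sub_eq_zero] at this
    exact ⟨_, this.symm⟩
  · refine (N.deg i).sub_mem ?_ (lin_deg f ?_)
    · split_ifs
      exacts [hx i, (N.deg i).zero_mem]
    · split_ifs
      exacts [hy i, (M.deg i).zero_mem]
  · rw [Finset.sum_sub_distrib, sub_eq_zero, ← Finset.sum_subset Finset.subset_union_left,
      ← Finset.sum_subset Finset.subset_union_right]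
    · refine Eq.trans (Finset.sum_congr rfl fun i hi => if_pos hi) (hm.symm.trans ?_)
      exact Finset.sum_congr rfl fun i hi => by rw [if_pos hi]
    · intro i _ hi; simp [hi]
    · intro i _ hi; simp [hi]

/-- The kernel of a morphism. -/
abbrev kerObj (f : M ⟶ N) : GrModR.{u, v, w} 𝒜 := M.sub (LinearMap.ker (lin f)) (ker_homogeneous f)

/-- The inclusion of the kernel. -/
def kerι (f : M ⟶ N) : kerObj f ⟶ M := ofLin (LinearMap.ker (lin f)).subtype fun _ _ h => h

/-- The cokernel of a morphism. -/
abbrev cokerObj (f : M ⟶ N) : GrModR.{u, v, w} 𝒜 :=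
  N.quot (LinearMap.range (lin f)) (range_homogeneous f)

/-- The projection to the cokernel. -/
def cokerπ (f : M ⟶ N) : N ⟶ cokerObj f :=
  ofLin (LinearMap.range (lin f)).mkQ fun _ x h => ⟨x, h, rfl⟩

theorem kerι_comp (f : M ⟶ N) : kerι f ≫ f = 0 := hom_ext fun x => x.2

theorem comp_cokerπ (f : M ⟶ N) : f ≫ cokerπ f = 0 :=
  hom_ext fun x => (Submodule.Quotient.mk_eq_zero _).2 ⟨x, rfl⟩

/-- An injective morphism reflects degrees. -/
theorem deg_of_injective (f : M ⟶ N) (hf : Function.Injective (lin f)) {i : ℤ} {x : M.carrier}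
    (h : lin f x ∈ N.deg i) : x ∈ M.deg i := by
  obtain ⟨s, y, hy, rfl⟩ := M.exists_sum x
  rw [map_sum] at h
  obtain ⟨h1, -, -⟩ := N.eq_of_sum s (fun j => lin f (y j)) (fun j => lin_deg f (hy j)) h rfl
  refine AddSubgroup.sum_mem _ fun j hj => ?_
  by_cases hji : j = i
  · exact hji ▸ hy j
  · have : y j = 0 := hf (by rw [h1 j hj hji, map_zero])
    rw [this]; exact (M.deg i).zero_mem

/-- Homogeneous elements lift along surjective morphisms. -/
theorem exists_deg_of_surjective (f : M ⟶ N) (hf : Function.Surjective (lin f)) {i : ℤ}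
    {y : N.carrier} (h : y ∈ N.deg i) : ∃ x ∈ M.deg i, lin f x = y := by
  obtain ⟨x, rfl⟩ := hf y
  obtain ⟨s, z, hz, rfl⟩ := M.exists_sum x
  rw [map_sum] at h
  obtain ⟨-, h2, h3⟩ := N.eq_of_sum s (fun j => lin f (z j)) (fun j => lin_deg f (hz j)) h rfl
  rw [map_sum]
  by_cases hi : i ∈ s
  · exact ⟨z i, hz i, h2 hi⟩
  · exact ⟨0, (M.deg i).zero_mem, by rw [h3 hi, map_zero]⟩

/-- An injective morphism is a kernel of every morphism that it forms an exact sequence with. -/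
def isLimitOfExact (f : M ⟶ N) (g : N ⟶ P) (hf : Function.Injective (lin f))
    (w : f ≫ g = 0) (h : ∀ y, lin g y = 0 → y ∈ LinearMap.range (lin f)) :
    IsLimit (KernelFork.ofι f w) :=
  KernelFork.IsLimit.ofι f w
    (fun {W} j hj => ofLin
      ((LinearEquiv.ofInjective (lin f) hf).symm.toLinearMap ∘ₗ
        LinearMap.codRestrict (LinearMap.range (lin f)) (lin j)
          (fun x => h _ (LinearMap.congr_fun (congrArg lin hj) x)))
      (fun i x hx => deg_of_injective f hf (by
        have := congrArg Subtype.val ((LinearEquiv.ofInjective (lin f) hf).apply_symm_apply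
          (LinearMap.codRestrict (LinearMap.range (lin f)) (lin j)
          (fun x => h _ (LinearMap.congr_fun (congrArg lin hj) x)) x))
        rw [LinearEquiv.ofInjective_apply] at this
        exact this.symm ▸ lin_deg j hx)))
    (fun {W} j hj => hom_ext fun x => by
      have := congrArg Subtype.val ((LinearEquiv.ofInjective (lin f) hf).apply_symm_apply
          (LinearMap.codRestrict (LinearMap.range (lin f)) (lin j)
          (fun x => h _ (LinearMap.congr_fun (congrArg lin hj) x)) x))
      rw [LinearEquiv.ofInjective_apply] at this
      exact this)
    (fun {W} j hj m hm => hom_ext fun x => hf (by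
      have := congrArg Subtype.val ((LinearEquiv.ofInjective (lin f) hf).apply_symm_apply
          (LinearMap.codRestrict (LinearMap.range (lin f)) (lin j)
          (fun x => h _ (LinearMap.congr_fun (congrArg lin hj) x)) x))
      rw [LinearEquiv.ofInjective_apply] at this
      exact (LinearMap.congr_fun (congrArg lin hm) x).trans this.symm))

/-- A surjective morphism is a cokernel of every morphism that it forms an exact sequence with. -/
def isColimitOfExact (f : M ⟶ N) (g : N ⟶ P) (hg : Function.Surjective (lin g))
    (w : f ≫ g = 0) (h : ∀ y, lin g y = 0 → y ∈ LinearMap.range (lin f)) :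
    IsColimit (CokernelCofork.ofπ g w) :=
  CokernelCofork.IsColimit.ofπ g w
    (fun {W} j hj => ofLin
      ((LinearMap.ker (lin g)).liftQ (lin j) (fun y hy => by
          obtain ⟨x, rfl⟩ := h y hy
          exact LinearMap.congr_fun (congrArg lin hj) x) ∘ₗ
        (LinearMap.quotKerEquivOfSurjective (lin g) hg).symm.toLinearMap)
      (fun i y hy => by
        obtain ⟨x, hx, rfl⟩ := exists_deg_of_surjective g hg hy
        rw [LinearMap.comp_apply, LinearEquiv.coe_coe, LinearMap.quotKerEquivOfSurjective_symm_apply,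
          Submodule.liftQ_apply]
        exact lin_deg j hx))
    (fun {W} j hj => hom_ext fun x => by
      rw [lin_comp, lin_ofLin, LinearMap.comp_apply, LinearMap.comp_apply, LinearEquiv.coe_coe,
        LinearMap.quotKerEquivOfSurjective_symm_apply, Submodule.liftQ_apply])
    (fun {W} j hj m hm => hom_ext fun y => by
      obtain ⟨x, rfl⟩ := hg y
      rw [lin_ofLin, LinearMap.comp_apply, LinearEquiv.coe_coe,
        LinearMap.quotKerEquivOfSurjective_symm_apply, Submodule.liftQ_apply]
      exact LinearMap.congr_fun (congrArg lin hm) x)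

theorem injective_of_mono (f : M ⟶ N) [Mono f] : Function.Injective (lin f) := by
  rw [← LinearMap.ker_eq_bot, LinearMap.ker_eq_bot']
  intro x hx
  have : kerι f = 0 := by rw [← cancel_mono f, kerι_comp, zero_comp]
  exact LinearMap.congr_fun (congrArg lin this) ⟨x, hx⟩

theorem surjective_of_epi (f : M ⟶ N) [Epi f] : Function.Surjective (lin f) := by
  intro y
  have : cokerπ f = 0 := by rw [← cancel_epi f, comp_cokerπ, comp_zero]
  exact (Submodule.Quotient.mk_eq_zero _).1 (LinearMap.congr_fun (congrArg lin this) y)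

instance : HasKernels (GrModR.{u, v, w} 𝒜) where
  has_limit f := HasLimit.mk ⟨_, isLimitOfExact (kerι f) f Subtype.val_injective (kerι_comp f)
    fun y hy => ⟨⟨y, hy⟩, rfl⟩⟩

instance : HasCokernels (GrModR.{u, v, w} 𝒜) where
  has_colimit f := HasColimit.mk ⟨_, isColimitOfExact f (cokerπ f) (Submodule.mkQ_surjective _)
    (comp_cokerπ f) fun _ hy => (Submodule.Quotient.mk_eq_zero _).1 hy⟩

instance : IsNormalMonoCategory (GrModR.{u, v, w} 𝒜) where
  normalMonoOfMono f _ := ⟨{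
    Z := cokerObj f
    g := cokerπ f
    w := comp_cokerπ f
    isLimit := isLimitOfExact f (cokerπ f) (injective_of_mono f) _
      fun _ hy => (Submodule.Quotient.mk_eq_zero _).1 hy }⟩

instance : IsNormalEpiCategory (GrModR.{u, v, w} 𝒜) where
  normalEpiOfEpi f _ := ⟨{
    W := kerObj f
    g := kerι f
    w := kerι_comp f
    isColimit := isColimitOfExact (kerι f) f (surjective_of_epi f) _
      fun y hy => ⟨⟨y, hy⟩, rfl⟩ }⟩

/-- The zero module. -/
def zeroObj : GrModR.{u, v, w} 𝒜 where
  carrier := PUnit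
  deg _ := ⊤
  isInternal := by
    rw [isInternal_addSubgroup_iff]
    exact ⟨fun _ _ _ _ _ _ => rfl, fun m => ⟨∅, fun _ => m, fun _ => trivial, rfl⟩⟩
  smul_mem _ _ _ _ _ _ := trivial

instance : HasZeroObject (GrModR.{u, v, w} 𝒜) where
  zero := ⟨zeroObj,
    { unique_to := fun X => ⟨⟨⟨0⟩, fun f => hom_ext fun x => by
        rw [show x = 0 from rfl, map_zero, map_zero]⟩⟩
      unique_from := fun X => ⟨⟨⟨0⟩, fun f => hom_ext fun x => rfl⟩⟩ }⟩

/-- The direct sum of two graded right modules. -/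
def prod (M N : GrModR.{u, v, w} 𝒜) : GrModR.{u, v, w} 𝒜 where
  carrier := M.carrier × N.carrier
  deg i := (M.deg i).prod (N.deg i)
  isInternal := by
    classical
    rw [isInternal_addSubgroup_iff]
    refine ⟨fun s x hx h i hi => Prod.ext ?_ ?_, fun m => ?_⟩
    · exact M.eq_zero_of_sum s (fun i => (x i).1) (fun i => (hx i).1)
        (by simpa [Prod.fst_sum] using congrArg Prod.fst h) i hi
    · exact N.eq_zero_of_sum s (fun i => (x i).2) (fun i => (hx i).2)
        (by simpa [Prod.snd_sum] using congrArg Prod.snd h) i hi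
    · obtain ⟨s, x, hx, h⟩ := M.exists_sum m.1
      obtain ⟨t, y, hy, h'⟩ := N.exists_sum m.2
      refine ⟨s ∪ t, fun i => (if i ∈ s then x i else 0, if i ∈ t then y i else 0),
        fun i => ⟨?_, ?_⟩, Prod.ext ?_ ?_⟩
      · dsimp only
        split_ifs
        exacts [hx i, (M.deg i).zero_mem]
      · dsimp only
        split_ifs
        exacts [hy i, (N.deg i).zero_mem]
      · rw [Prod.fst_sum, ← h, ← Finset.sum_subset Finset.subset_union_left]
        · exact Finset.sum_congr rfl fun i hi => if_pos hi
        · intro i _ hi; exact if_neg hi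
      · rw [Prod.snd_sum, ← h', ← Finset.sum_subset Finset.subset_union_right]
        · exact Finset.sum_congr rfl fun i hi => if_pos hi
        · intro i _ hi; exact if_neg hi
  smul_mem i n a m ha hm := ⟨M.smul_mem i n a _ ha hm.1, N.smul_mem i n a _ ha hm.2⟩

instance : HasBinaryProducts (GrModR.{u, v, w} 𝒜) := by
  have : ∀ M N : GrModR.{u, v, w} 𝒜, HasLimit (pair M N) := fun M N => HasLimit.mk
    ⟨BinaryFan.mk (P := M.prod N) (ofLin (LinearMap.fst Aᵐᵒᵖ _ _) fun _ _ h => h.1)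
      (ofLin (LinearMap.snd Aᵐᵒᵖ _ _) fun _ _ h => h.2),
    BinaryFan.IsLimit.mk _
      (fun f g => ofLin ((lin f).prod (lin g)) fun i x h => ⟨lin_deg f h, lin_deg g h⟩)
      (fun f g => rfl) (fun f g => rfl)
      (fun f g m hf hg => hom_ext fun x => Prod.ext
        (LinearMap.congr_fun (congrArg lin hf) x) (LinearMap.congr_fun (congrArg lin hg) x))⟩
  exact hasBinaryProducts_of_hasLimit_pair _

instance : HasFiniteProducts (GrModR.{u, v, w} 𝒜) :=
  have : HasTerminal (GrModR.{u, v, w} 𝒜) := HasZeroObject.hasTerminal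
  hasFiniteProducts_of_has_binary_and_terminal

/-- Graded right modules form an abelian category. -/
instance : Abelian (GrModR.{u, v, w} 𝒜) where

/-- The shift `M[d]`, with `M[d]_i = M_{i+d}`. A graded homomorphism of degree `d` from `N` to `M`
is a morphism `N ⟶ M[d]`. -/
def shift (M : GrModR.{u, v, w} 𝒜) (d : ℤ) : GrModR.{u, v, w} 𝒜 where
  carrier := M.carrier
  deg i := M.deg (i + d)
  isInternal := by
    rw [isInternal_addSubgroup_iff]
    refine ⟨fun s x hx h i hi => ?_, fun m => ?_⟩
    · have := M.eq_zero_of_sum (s.map (Equiv.addRight d).toEmbedding) (fun j => x (j - d))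
        (fun j => by simpa using hx (j - d)) (by simpa using h) (i + d) (by simpa using hi)
      simpa using this
    · obtain ⟨s, x, hx, h⟩ := M.exists_sum m
      exact ⟨s.map (Equiv.subRight d).toEmbedding, fun j => x (j + d), fun j => hx (j + d),
        by simpa using h⟩
  smul_mem i n a m ha hm := by
    have := M.smul_mem (i + d) n a m ha hm
    rwa [add_right_comm] at this

/-- `Ext` groups of graded right modules exist. -/
instance : HasExt.{max u (w + 1)} (GrModR.{u, v, w} 𝒜) := HasExt.standard _

/-- The graded Ext group `grExt^j(M, N) = ⨁ d, Ext^j(M, N[d])`, with `Ext` taken in the abelian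
category of graded right modules: the `j`-th right derived functor of
`grHom(M, N) = ⨁ d, Hom(M, N[d])`. -/
abbrev grExt (M N : GrModR.{u, v, w} 𝒜) (j : ℕ) : Type (max u (w + 1)) :=
  DirectSum ℤ fun d => Abelian.Ext M (N.shift d) j

section Self

variable (𝒜) [GradedAlgebra 𝒜]

/-- The homogeneous parts of `A`, indexed by `ℤ` (zero in negative degrees). -/
def selfDeg : ℤ → AddSubgroup A
  | Int.ofNat n => (𝒜 n).toAddSubgroup
  | Int.negSucc _ => ⊥

/-- The algebra `A` as a graded right module over itself. -/
def self : GrModR.{u, v, u} 𝒜 where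
  carrier := A
  deg := selfDeg 𝒜
  isInternal := by
    classical
    have hA : DirectSum.IsInternal fun n => (𝒜 n).toAddSubgroup :=
      DirectSum.Decomposition.isInternal 𝒜
    rw [isInternal_addSubgroup_iff] at hA ⊢
    refine ⟨fun s x hx h => ?_, fun m => ?_⟩
    · have hneg : ∀ n, x (Int.negSucc n) = 0 := fun n => hx (Int.negSucc n)
      have hsum : ∑ n ∈ s.preimage Int.ofNat Int.ofNat_injective.injOn, x (Int.ofNat n) = 0 := by
        rw [Finset.sum_preimage Int.ofNat s Int.ofNat_injective.injOn x, h]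
        rintro (n | n) _ hn
        · exact absurd ⟨n, rfl⟩ hn
        · exact hneg n
      rintro (n | n) hi
      · exact hA.1 _ (fun n => x (Int.ofNat n)) (fun n => hx (Int.ofNat n)) hsum n (by simpa using hi)
      · exact hneg n
    · obtain ⟨s, x, hx, h⟩ := hA.2 m
      refine ⟨s.map ⟨Int.ofNat, Int.ofNat_injective⟩, fun i => if 0 ≤ i then x i.toNat else 0,
        ?_, by simpa using h⟩
      rintro (n | n)
      · exact hx n
      · exact (if_neg (Int.negSucc_not_nonneg n).1 : _ = (0 : A))
  smul_mem := by
    rintro (i | i) n a m ha hm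
    · exact SetLike.GradedMul.mul_mem (A := 𝒜) hm ha
    · rw [show m = 0 from hm, smul_zero]
      exact AddSubgroup.zero_mem _

/-- The graded Jacobson radical: the intersection of the maximal homogeneous right ideals. -/
def gradedRadical : Submodule Aᵐᵒᵖ A :=
  sInf {J | Maximal (fun K : Submodule Aᵐᵒᵖ A => K.IsHomogeneous 𝒜 ∧ K ≠ ⊤) J}

theorem gradedRadical_homogeneous (s : Finset ℤ) (x : ℤ → A) (hx : ∀ i, x i ∈ selfDeg 𝒜 i)
    (h : ∑ i ∈ s, x i ∈ gradedRadical 𝒜) : ∀ i ∈ s, x i ∈ gradedRadical 𝒜 := by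
  classical
  intro i hi
  rw [gradedRadical, Submodule.mem_sInf] at h ⊢
  intro J hJ
  have hs := h J hJ
  rcases i with n | n
  · have := hJ.1.1 n hs
    rw [DirectSum.decompose_sum, DFinsupp.finsetSum_apply, AddSubmonoidClass.coe_finsetSum,
      Finset.sum_eq_single (Int.ofNat n)] at this
    · rwa [DirectSum.decompose_of_mem_same 𝒜 (hx (Int.ofNat n))] at this
    · rintro (m | m) _ hm
      · exact DirectSum.decompose_of_mem_ne 𝒜 (hx (Int.ofNat m)) (fun h => hm (by rw [h]))
      · rw [show x (Int.negSucc m) = 0 from hx (Int.negSucc m)]; simp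
    · exact fun hn => absurd hi hn
  · rw [show x (Int.negSucc n) = 0 from hx (Int.negSucc n)]
    exact J.zero_mem

/-- The graded right module `S = A / grJ(A)`. -/
def top : GrModR.{u, v, u} 𝒜 := (self 𝒜).quot (gradedRadical 𝒜) (gradedRadical_homogeneous 𝒜)

end Self

end GrModR

/-- The depth of a graded algebra: the least `j` with `grExt^j(S, A) ≠ 0`, for `S = A / grJ(A)`
(`⊤` if there is no such `j`). -/
def gradedDepth {k : Type v} [Field k] {A : Type u} [Ring A] [Algebra k A] (𝒜 : ℕ → Submodule k A)
    [GradedAlgebra 𝒜] : ℕ∞ :=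
  ⨅ (j : ℕ) (_ : Nontrivial (GrModR.grExt (GrModR.top 𝒜) (GrModR.self 𝒜) j)), (j : ℕ∞)

/-- The span `V^n` of the products of at most `n` elements of `V`. -/
def growthSpace {k : Type v} [Field k] {A : Type u} [Ring A] [Algebra k A] (V : Submodule k A)
    (n : ℕ) : Submodule k A := ⨆ m ≤ n, V ^ m

/-- `A` has Gelfand-Kirillov dimension `d`: it has a finite dimensional generating subspace, and
`limsup log (dim V^n) / log n = d` for every such subspace `V`. -/
def HasGKDim (k : Type v) [Field k] (A : Type u) [Ring A] [Algebra k A] (d : EReal) : Prop :=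
  (∃ V : Submodule k A, FiniteDimensional k V ∧ Algebra.adjoin k (V : Set A) = ⊤) ∧
  ∀ V : Submodule k A, FiniteDimensional k V → Algebra.adjoin k (V : Set A) = ⊤ →
    Filter.limsup (fun n : ℕ =>
      ((Real.log (Module.finrank k (growthSpace V n)) / Real.log n : ℝ) : EReal)) Filter.atTop = d

/-- A quiver with vertices `V` and arrows `E`. -/
structure ArrowQuiver (V : Type u) (E : Type v) where
  /-- the source of an arrow -/
  s : E → V
  /-- the target of an arrow -/
  t : E → V

namespace ArrowQuiver

variable {V : Type u} {E : Type v} (Q : ArrowQuiver V E)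

/-- The list `l` of arrows can be traversed starting from the vertex `x`. -/
def IsWalk : V → List E → Prop
  | _, [] => True
  | x, a :: l => Q.s a = x ∧ IsWalk (Q.t a) l

/-- The vertex reached from `x` after traversing the arrows of `l`. -/
def endpoint : V → List E → V
  | x, [] => x
  | _, a :: l => endpoint (Q.t a) l

theorem isWalk_append (x : V) (l l' : List E) :
    Q.IsWalk x (l ++ l') ↔ Q.IsWalk x l ∧ Q.IsWalk (Q.endpoint x l) l' := by
  induction l generalizing x with
  | nil => simp [IsWalk, endpoint]
  | cons a l ih => simp [IsWalk, endpoint, ih, and_assoc]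

theorem endpoint_append (x : V) (l l' : List E) :
    Q.endpoint x (l ++ l') = Q.endpoint (Q.endpoint x l) l' := by
  induction l generalizing x with
  | nil => rfl
  | cons a l ih => exact ih _

/-- A path: a source vertex and a composable list of arrows starting there. The empty list gives
the stationary path. -/
@[ext]
structure Path where
  src : V
  arrows : List E
  isWalk : Q.IsWalk src arrows

namespace Path

variable {Q}

/-- The target of a path. -/
def tgt (p : Q.Path) : V := Q.endpoint p.src p.arrows

/-- The length of a path. -/
def length (p : Q.Path) : ℕ := p.arrows.length

/-- The concatenation `pq` of two paths with `t(p) = s(q)`. -/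
def comp (p q : Q.Path) (h : p.tgt = q.src) : Q.Path where
  src := p.src
  arrows := p.arrows ++ q.arrows
  isWalk := (Q.isWalk_append _ _ _).2 ⟨p.isWalk, by
    change Q.IsWalk p.tgt q.arrows
    rw [h]; exact q.isWalk⟩

theorem tgt_comp (p q : Q.Path) (h : p.tgt = q.src) : (p.comp q h).tgt = q.tgt := by
  change Q.endpoint p.src (p.arrows ++ q.arrows) = Q.endpoint q.src q.arrows
  rw [endpoint_append, ← h]; rfl

variable (Q) in
/-- The stationary path at a vertex. -/
def stationary (x : V) : Q.Path := ⟨x, [], trivial⟩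

variable (Q) in
/-- An arrow as a path of length one. -/
def arrow (a : E) : Q.Path := ⟨Q.s a, [a], rfl, trivial⟩

end Path

/-- The path algebra `kQ`: the vector space with basis the paths of `Q`. -/
def PathAlgebra (k : Type w) [Field k] (Q : ArrowQuiver V E) : Type (max u v w) := Q.Path →₀ k

namespace PathAlgebra

variable (k : Type w) [Field k]

instance : AddCommGroup (Q.PathAlgebra k) := inferInstanceAs (AddCommGroup (Q.Path →₀ k))
instance : Module k (Q.PathAlgebra k) := inferInstanceAs (Module k (Q.Path →₀ k))

variable {Q}

/-- The basis element of `kQ` given by a path. -/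
def ofPath (p : Q.Path) : Q.PathAlgebra k := Finsupp.single p 1

variable {k} in
@[elab_as_elim]
theorem induction {C : Q.PathAlgebra k → Prop} (x : Q.PathAlgebra k) (zero : C 0)
    (add : ∀ x y, C x → C y → C (x + y)) (smul : ∀ (c : k) (p : Q.Path), C (c • ofPath k p)) :
    C x :=
  Finsupp.induction_linear x zero add fun p c => by
    have := smul c p
    rwa [show c • ofPath k p = Finsupp.single p c by
      exact (Finsupp.smul_single _ _ _).trans (by rw [smul_eq_mul, mul_one])] at this

open Classical in
/-- The product of two paths in `kQ`: their concatenation if they are composable, otherwise `0`. -/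
def pathMul (p q : Q.Path) : Q.PathAlgebra k :=
  if h : p.tgt = q.src then ofPath k (p.comp q h) else 0

variable (Q) in
/-- The bilinear extension of the product of paths. -/
def mulLin : Q.PathAlgebra k →ₗ[k] Q.PathAlgebra k →ₗ[k] Q.PathAlgebra k :=
  Finsupp.linearCombination k fun p => Finsupp.linearCombination k fun q => pathMul k p q

theorem mulLin_ofPath (p q : Q.Path) : mulLin Q k (ofPath k p) (ofPath k q) = pathMul k p q := by
  have h1 : mulLin Q k (ofPath k p) = Finsupp.linearCombination k fun q => pathMul k p q :=
    (Finsupp.linearCombination_single k 1 p).trans (one_smul _ _)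
  rw [h1]
  exact (Finsupp.linearCombination_single k 1 q).trans (one_smul _ _)

theorem mulLin_assoc (x y z : Q.PathAlgebra k) :
    mulLin Q k (mulLin Q k x y) z = mulLin Q k x (mulLin Q k y z) := by
  induction x using PathAlgebra.induction with
  | zero => simp
  | add x x' h h' => simp [h, h']
  | smul c p =>
  induction y using PathAlgebra.induction with
  | zero => simp
  | add x x' h h' => simp only [map_add, LinearMap.add_apply, h, h']
  | smul c' q =>
  induction z using PathAlgebra.induction with
  | zero => simp
  | add x x' h h' => simp only [map_add, h, h']
  | smul c'' r =>
    simp only [map_smul, LinearMap.smul_apply, mulLin_ofPath]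
    congr 3
    unfold pathMul
    by_cases h : p.tgt = q.src
    · by_cases h' : q.tgt = r.src
      · rw [dif_pos h, dif_pos h', mulLin_ofPath, mulLin_ofPath, pathMul, pathMul,
          dif_pos ((Path.tgt_comp p q h).trans h'), dif_pos (show p.tgt = (q.comp r h').src from h)]
        congr 1
        exact Path.ext rfl (List.append_assoc _ _ _)
      · rw [dif_pos h, dif_neg h', mulLin_ofPath, pathMul, map_zero,
          dif_neg (by rwa [Path.tgt_comp])]
    · rw [dif_neg h, map_zero, LinearMap.zero_apply]
      split_ifs with h'
      · rw [mulLin_ofPath, pathMul, dif_neg (show ¬ p.tgt = (q.comp r h').src from h)]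
      · rw [map_zero]

instance : Mul (Q.PathAlgebra k) := ⟨fun x y => mulLin Q k x y⟩

theorem ofPath_mul (p q : Q.Path) : ofPath k p * ofPath k q = pathMul k p q := mulLin_ofPath k p q

variable [Fintype V]

/-- The unit of `kQ` is the sum of the stationary paths. -/
instance : One (Q.PathAlgebra k) := ⟨∑ x, ofPath k (Path.stationary Q x)⟩

theorem one_mul' (x : Q.PathAlgebra k) : 1 * x = x := by
  classical
  change mulLin Q k (∑ v, ofPath k (Path.stationary Q v)) x = x
  induction x using PathAlgebra.induction with
  | zero => simp
  | add x x' h h' => rw [map_add, h, h']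
  | smul c p =>
    rw [map_smul, map_sum, LinearMap.sum_apply, Finset.sum_eq_single p.src]
    · rw [mulLin_ofPath, pathMul, dif_pos (show (Path.stationary Q p.src).tgt = p.src from rfl)]; rfl
    · intro v _ hv
      rw [mulLin_ofPath, pathMul, dif_neg (show ¬ (Path.stationary Q v).tgt = p.src from hv)]
    · exact fun h => absurd (Finset.mem_univ _) h

theorem mul_one' (x : Q.PathAlgebra k) : x * 1 = x := by
  classical
  change mulLin Q k x (∑ v, ofPath k (Path.stationary Q v)) = x
  induction x using PathAlgebra.induction with
  | zero => simp
  | add x x' h h' => rw [map_add, LinearMap.add_apply, h, h']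
  | smul c p =>
    rw [map_smul, LinearMap.smul_apply, map_sum, Finset.sum_eq_single p.tgt]
    · rw [mulLin_ofPath, pathMul, dif_pos (show p.tgt = (Path.stationary Q p.tgt).src from rfl)]
      congr 2
      exact Path.ext rfl (List.append_nil _)
    · intro v _ hv
      rw [mulLin_ofPath, pathMul, dif_neg (show ¬ p.tgt = (Path.stationary Q v).src from Ne.symm hv)]
    · exact fun h => absurd (Finset.mem_univ _) h

instance : Ring (Q.PathAlgebra k) where
  __ := (inferInstance : AddCommGroup (Q.PathAlgebra k))
  left_distrib x y z := map_add (mulLin Q k x) y z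
  right_distrib x y z := LinearMap.map_add₂ (mulLin Q k) x y z
  zero_mul x := LinearMap.map_zero₂ (mulLin Q k) x
  mul_zero x := map_zero (mulLin Q k x)
  mul_assoc := mulLin_assoc k
  one_mul := one_mul' k
  mul_one := mul_one' k

instance : Algebra k (Q.PathAlgebra k) :=
  Algebra.ofModule (fun c x y => LinearMap.map_smul₂ (mulLin Q k) c x y)
    (fun c x y => map_smul (mulLin Q k x) c y)

end PathAlgebra

/-- The linear span in `kQ` of the paths of length `n`. -/
def pathDeg (k : Type w) [Field k] (n : ℕ) : Submodule k (Q.PathAlgebra k) :=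
  Submodule.span k (PathAlgebra.ofPath k '' {p : Q.Path | p.length = n})

theorem ofPath_mem_pathDeg (k : Type w) [Field k] {Q : ArrowQuiver V E} (p : Q.Path) :
    PathAlgebra.ofPath k p ∈ Q.pathDeg k p.length :=
  Submodule.subset_span ⟨p, rfl, rfl⟩

variable [Fintype V]

/-- The two-sided ideal of `kQ` generated by a set of paths. -/
def pathIdeal (k : Type w) [Field k] (R : Set Q.Path) : Ideal (Q.PathAlgebra k) :=
  (TwoSidedIdeal.span (PathAlgebra.ofPath k '' R)).asIdeal

instance (k : Type w) [Field k] (R : Set Q.Path) : (Q.pathIdeal k R).IsTwoSided :=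
  inferInstanceAs ((TwoSidedIdeal.span (PathAlgebra.ofPath k '' R)).asIdeal.IsTwoSided)

/-- The algebra `A = kQ / I` for the ideal `I` generated by the set of paths `R`. -/
abbrev BoundAlgebra (k : Type w) [Field k] (R : Set Q.Path) : Type (max u v w) :=
  Q.PathAlgebra k ⧸ Q.pathIdeal k R

/-- The grading of `A = kQ / I` by path length. -/
def grading (k : Type w) [Field k] (R : Set Q.Path) (n : ℕ) : Submodule k (Q.BoundAlgebra k R) :=
  (Q.pathDeg k n).map (Ideal.Quotient.mkₐ k (Q.pathIdeal k R)).toLinearMap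

section Grading

variable (k : Type w) [Field k] {Q}

theorem pathDeg_mul {m n : ℕ} {x y : Q.PathAlgebra k} (hx : x ∈ Q.pathDeg k m)
    (hy : y ∈ Q.pathDeg k n) : x * y ∈ Q.pathDeg k (m + n) := by
  induction hx using Submodule.span_induction with
  | zero => rw [zero_mul]; exact Submodule.zero_mem _
  | add a b _ _ ha hb => rw [add_mul]; exact Submodule.add_mem _ ha hb
  | smul c a _ ha => rw [smul_mul_assoc]; exact Submodule.smul_mem _ _ ha
  | mem a ha =>
  obtain ⟨p, rfl, rfl⟩ := ha
  induction hy using Submodule.span_induction with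
  | zero => rw [mul_zero]; exact Submodule.zero_mem _
  | add a b _ _ ha hb => rw [mul_add]; exact Submodule.add_mem _ ha hb
  | smul c a _ ha => rw [mul_smul_comm]; exact Submodule.smul_mem _ _ ha
  | mem a ha =>
  obtain ⟨q, rfl, rfl⟩ := ha
  rw [PathAlgebra.ofPath_mul, PathAlgebra.pathMul]
  split_ifs with h
  · exact Submodule.subset_span ⟨p.comp q h, List.length_append, rfl⟩
  · exact Submodule.zero_mem _

open Classical in
/-- The projection of `kQ` to its part of degree `n`. -/
def pathProj (Q : ArrowQuiver V E) (n : ℕ) : Q.PathAlgebra k →ₗ[k] Q.PathAlgebra k :=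
  Finsupp.linearCombination k fun p : Q.Path => if p.length = n then PathAlgebra.ofPath k p else 0

theorem pathProj_ofPath (n : ℕ) (p : Q.Path) : pathProj k Q n (PathAlgebra.ofPath k p) =
    if p.length = n then PathAlgebra.ofPath k p else 0 := by
  classical
  refine (Finsupp.linearCombination_single k 1 p).trans ?_
  rw [one_smul]

theorem pathProj_of_mem {m : ℕ} {x : Q.PathAlgebra k} (n : ℕ) (hx : x ∈ Q.pathDeg k m) :
    pathProj k Q n x = if m = n then x else 0 := by
  induction hx using Submodule.span_induction with
  | zero => simp
  | add a b _ _ ha hb => rw [map_add, ha, hb]; split_ifs <;> simp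
  | smul c a _ ha => rw [map_smul, ha]; split_ifs <;> simp
  | mem a ha =>
    obtain ⟨p, rfl, rfl⟩ := ha
    exact pathProj_ofPath k n p

theorem exists_path_sum (x : Q.PathAlgebra k) : ∃ (s : Finset ℕ) (y : ℕ → Q.PathAlgebra k),
    (∀ i, y i ∈ Q.pathDeg k i) ∧ ∑ i ∈ s, y i = x := by
  have hm : ∀ n, pathProj k Q n x ∈ Q.pathDeg k n := by
    intro n
    induction x using PathAlgebra.induction with
    | zero => rw [map_zero]; exact Submodule.zero_mem _
    | add a b ha hb => rw [map_add]; exact Submodule.add_mem _ ha hb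
    | smul c p =>
      rw [map_smul, pathProj_ofPath]
      refine Submodule.smul_mem _ _ ?_
      split_ifs with h
      · exact h ▸ ofPath_mem_pathDeg k p
      · exact Submodule.zero_mem _
  have hs : ∃ N, ∀ N' ≥ N, ∑ n ∈ Finset.range N', pathProj k Q n x = x := by
    clear hm
    induction x using PathAlgebra.induction with
    | zero => exact ⟨0, fun _ _ => by simp⟩
    | add a b ha hb =>
      obtain ⟨N, hN⟩ := ha
      obtain ⟨M, hM⟩ := hb
      refine ⟨max N M, fun N' h => ?_⟩
      simp only [map_add, Finset.sum_add_distrib]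
      rw [hN N' (le_trans (le_max_left _ _) h), hM N' (le_trans (le_max_right _ _) h)]
    | smul c p =>
      refine ⟨p.length + 1, fun N' h => ?_⟩
      rw [Finset.sum_eq_single p.length]
      · rw [map_smul, pathProj_ofPath, if_pos rfl]
      · intro n _ hn
        rw [map_smul, pathProj_ofPath, if_neg (Ne.symm hn), smul_zero]
      · exact fun hn => absurd (Finset.mem_range.2 h) hn
  obtain ⟨N, hN⟩ := hs
  exact ⟨Finset.range N, fun n => pathProj k Q n x, hm, hN N le_rfl⟩

theorem pathProj_mem_pathIdeal (R : Set Q.Path) (n : ℕ) {x : Q.PathAlgebra k}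
    (hx : x ∈ Q.pathIdeal k R) : pathProj k Q n x ∈ Q.pathIdeal k R := by
  change x ∈ TwoSidedIdeal.span _ at hx
  rw [TwoSidedIdeal.mem_span_iff_mem_addSubgroup_closure] at hx
  induction hx using AddSubgroup.closure_induction with
  | zero => rw [map_zero]; exact Submodule.zero_mem _
  | add a b _ _ ha hb => rw [map_add]; exact Submodule.add_mem _ ha hb
  | neg a _ ha => rw [map_neg]; exact Submodule.neg_mem _ ha
  | mem z hz =>
    obtain ⟨_, ⟨a, -, _, ⟨r, hr, rfl⟩, rfl⟩, b, -, rfl⟩ := hz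
    dsimp only
    have hI : ∀ a b, a * PathAlgebra.ofPath k r * b ∈ Q.pathIdeal k R := fun a b =>
      TwoSidedIdeal.mul_mem_right _ _ _ (TwoSidedIdeal.mul_mem_left _ _ _
        (TwoSidedIdeal.subset_span ⟨r, hr, rfl⟩))
    induction a using PathAlgebra.induction with
    | zero => simp
    | add a a' h h' => rw [add_mul, add_mul, map_add]; exact Submodule.add_mem _ h h'
    | smul c p =>
    induction b using PathAlgebra.induction with
    | zero => simp
    | add a a' h h' => rw [mul_add, map_add]; exact Submodule.add_mem _ h h'
    | smul c' q =>
    rw [pathProj_of_mem k n (pathDeg_mul k (pathDeg_mul k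
      (Submodule.smul_mem _ c (ofPath_mem_pathDeg k p)) (ofPath_mem_pathDeg k r))
      (Submodule.smul_mem _ c' (ofPath_mem_pathDeg k q)))]
    split_ifs
    · exact hI _ _
    · exact Submodule.zero_mem _

theorem grading_isInternal (R : Set Q.Path) : DirectSum.IsInternal (Q.grading k R) := by
  have : DirectSum.IsInternal fun n => (Q.grading k R n).toAddSubgroup := by
    rw [isInternal_addSubgroup_iff]
    refine ⟨fun s x hx h i hi => ?_, fun m => ?_⟩
    · choose y hy hyx using hx
      have hy' : ∀ i, Ideal.Quotient.mk (Q.pathIdeal k R) (y i) = x i := hyx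
      rw [← hy', Ideal.Quotient.eq_zero_iff_mem]
      rw [← Finset.sum_congr rfl fun i _ => hy' i, ← map_sum, Ideal.Quotient.eq_zero_iff_mem] at h
      have := pathProj_mem_pathIdeal k R i h
      rw [map_sum, Finset.sum_eq_single i] at this
      · rwa [pathProj_of_mem k i (hy i), if_pos rfl] at this
      · intro j _ hj; rw [pathProj_of_mem k i (hy j), if_neg hj]
      · exact fun h => absurd hi h
    · obtain ⟨m, rfl⟩ := Ideal.Quotient.mk_surjective m
      obtain ⟨s, y, hy, rfl⟩ := exists_path_sum k m
      exact ⟨s, fun i => Ideal.Quotient.mk _ (y i), fun i => ⟨y i, hy i, rfl⟩, (map_sum _ _ _).symm⟩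
  exact this

instance (R : Set Q.Path) : GradedAlgebra (Q.grading k R) where
  __ := (grading_isInternal k R).chooseDecomposition
  one_mem := by
    refine ⟨1, ?_, rfl⟩
    exact Submodule.sum_mem _ fun x _ => ofPath_mem_pathDeg k (Path.stationary Q x)
  mul_mem := by
    rintro i j _ _ ⟨x, hx, rfl⟩ ⟨y, hy, rfl⟩
    exact ⟨x * y, pathDeg_mul k hx hy, rfl⟩

end Grading

section Gentle

variable (k : Type w) [Field k] (R : Set Q.Path)

/-- The class of a path in `A = kQ / I`. -/
def pathClass (p : Q.Path) : Q.BoundAlgebra k R :=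
  Ideal.Quotient.mk (Q.pathIdeal k R) (PathAlgebra.ofPath k p)

/-- The class of an arrow in `A = kQ / I`. -/
def arrowClass (a : E) : Q.BoundAlgebra k R := Q.pathClass k R (Path.arrow Q a)

/-- The common conditions on gentle and locally gentle algebras `A = kQ / I`, where `Q` is a finite
quiver and `I` is the ideal generated by `R`. A product of paths lies in `I` exactly if the product
of their classes in `A` is zero. -/
structure IsGentlePresentation : Prop where
  /-- the underlying graph is connected -/
  connected : (SimpleGraph.fromRel fun x y => ∃ a, Q.s a = x ∧ Q.t a = y).Connected
  indeg_le : ∀ x, {a | Q.t a = x}.ncard ≤ 2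
  outdeg_le : ∀ x, {a | Q.s a = x}.ncard ≤ 2
  left_unique : ∀ a b b', Q.s a = Q.t b → Q.s a = Q.t b' → b ≠ b' →
    Xor (Q.arrowClass k R b * Q.arrowClass k R a = 0)
      (Q.arrowClass k R b' * Q.arrowClass k R a = 0)
  right_unique : ∀ a b b', Q.t a = Q.s b → Q.t a = Q.s b' → b ≠ b' →
    Xor (Q.arrowClass k R a * Q.arrowClass k R b = 0)
      (Q.arrowClass k R a * Q.arrowClass k R b' = 0)
  /-- the ideal is generated by paths of length two -/
  length_two : ∀ p ∈ R, p.length = 2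

/-- `A = kQ / I` is gentle. -/
def IsGentle : Prop :=
  Q.IsGentlePresentation k R ∧ FiniteDimensional k (Q.BoundAlgebra k R)

/-- `A = kQ / I` is locally gentle. -/
def IsLocallyGentle : Prop :=
  Q.IsGentlePresentation k R ∧ ¬ FiniteDimensional k (Q.BoundAlgebra k R)

/-- `p` is a finite maximal path of `A`: a path, nonzero in `A`, whose product with every arrow on
either side is zero in `A`. -/
def IsFiniteMaximalPath (p : Q.Path) : Prop :=
  Q.pathClass k R p ≠ 0 ∧ (∀ a, Q.pathClass k R p * Q.arrowClass k R a = 0) ∧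
    ∀ a, Q.arrowClass k R a * Q.pathClass k R p = 0

/-- `c` is a cycle in `A`: a closed path of positive length that is nonzero in `A`. -/
def IsCycleIn (c : Q.Path) : Prop := c.src = c.tgt ∧ 0 < c.length ∧ Q.pathClass k R c ≠ 0

/-- `c` is a primitive cycle in `A`: it is not a proper power of a cycle in `A`. -/
def IsPrimitiveCycle (c : Q.Path) : Prop :=
  Q.IsCycleIn k R c ∧ ¬ ∃ (c' : Q.Path) (n : ℕ), Q.IsCycleIn k R c' ∧ 1 < n ∧
    PathAlgebra.ofPath k c = PathAlgebra.ofPath k c' ^ n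

/-- `A` has an infinite maximal path: the word `c^∞` for some primitive cycle `c` with `c² ∉ I`. -/
def HasInfiniteMaximalPath : Prop :=
  ∃ c, Q.IsPrimitiveCycle k R c ∧ Q.pathClass k R c ^ 2 ≠ 0

end Gentle

end ArrowQuiver

end

/-! Since `R` consists of paths of length two, the ideal is monomial and quadratic: a path is
nonzero in `A` exactly when every two consecutive arrows have nonzero product
(`pathClass_ne_zero_iff`), and the nonzero paths form a basis of `A`. Gentleness makes the relation
`Follows` a partial function on arrows: an arrow has at most one continuation
(`IsGentlePresentation.follows_right_unique`). The algebra is thereby reduced to the combinatorics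
of a finite set with a partial map.

Depth. The graded radical `J` is spanned by the paths of positive length, so a graded map `S → A[d]`
is left multiplication by an element `m` with `mJ = 0`, and every path in the support of such an `m`
is maximal on the right. A pigeonhole argument on arrows (`exists_isFiniteMaximalPath`) shows that a
right maximal path exists only if there is a path maximal on both sides. This decides depth zero. In
general, `0 → J → A → S → 0` turns any graded map `J → A[d]` that is not a left multiplication into
a nonzero class in the first Ext group. Without finite maximal paths there are arrows with `ab ≠ 0`.
If another arrow `c` starts where `b` does, the map fixing one of `b`, `c` and killing all other
arrows works; otherwise `a ↦ e`, with `e` the stationary path at the target of `a` and all other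
arrows sent to zero, is well defined and works.

Infinite maximal paths. A nonzero path longer than the number of arrows repeats an arrow, and the
segment between two occurrences is a closed path with nonzero square; a shortest such closed path is
primitive. Conversely, the powers of a cycle with nonzero square are nonzero paths of unbounded
length.

Growth. A nonzero path is determined by its source, its first arrow and its length, so the number of
nonzero paths of length at most `N` is at most linear in `N`. On the other hand, the spaces `V^n`
increase strictly when `A` is infinite dimensional, so the growth is exactly linear. -/

noncomputable section

namespace ArrowQuiver

/-! ### The basis of nonzero paths and the quadratic criterion for nonvanishing -/

section PathBasis

variable {k : Type w} [Field k] {V : Type u} {E : Type v} [Fintype V] {Q : ArrowQuiver V E}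
  {R : Set Q.Path}

theorem pathClass_mul (p q : Q.Path) (h : p.tgt = q.src) :
    Q.pathClass k R p * Q.pathClass k R q = Q.pathClass k R (p.comp q h) := by
  unfold pathClass
  rw [← map_mul, PathAlgebra.ofPath_mul, PathAlgebra.pathMul, dif_pos h]

theorem pathClass_mul_of_ne (p q : Q.Path) (h : p.tgt ≠ q.src) :
    Q.pathClass k R p * Q.pathClass k R q = 0 := by
  unfold pathClass
  rw [← map_mul, PathAlgebra.ofPath_mul, PathAlgebra.pathMul, dif_neg h, map_zero]

theorem comp_of_mul_ne_zero {p q : Q.Path} (h : Q.pathClass k R p * Q.pathClass k R q ≠ 0) :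
    ∃ h' : p.tgt = q.src, Q.pathClass k R (p.comp q h') ≠ 0 := by
  by_cases h' : p.tgt = q.src
  · exact ⟨h', by rwa [← pathClass_mul]⟩
  · exact absurd (pathClass_mul_of_ne p q h') h

@[elab_as_elim]
theorem BoundAlgebra.induction {C : Q.BoundAlgebra k R → Prop} (x : Q.BoundAlgebra k R) (zero : C 0)
    (add : ∀ x y, C x → C y → C (x + y))
    (smul : ∀ (c : k) (p : Q.Path), C (c • Q.pathClass k R p)) : C x := by
  obtain ⟨x, rfl⟩ := Ideal.Quotient.mk_surjective x
  induction x using PathAlgebra.induction with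
  | zero => rwa [map_zero]
  | add x y hx hy => rw [map_add]; exact add _ _ hx hy
  | smul c p => exact smul c p

/-- A span of paths that contains all multiples of the generators contains the ideal. -/
theorem mem_span_of_mem_pathIdeal (S : Set Q.Path)
    (hS : ∀ (p r q : Q.Path) (h : p.tgt = r.src) (h' : (p.comp r h).tgt = q.src), r ∈ R →
      (p.comp r h).comp q h' ∈ S) {x : Q.PathAlgebra k} (hx : x ∈ Q.pathIdeal k R) :
    x ∈ Submodule.span k (PathAlgebra.ofPath k '' S) := by
  change x ∈ TwoSidedIdeal.span _ at hx
  rw [TwoSidedIdeal.mem_span_iff_mem_addSubgroup_closure] at hx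
  induction hx using AddSubgroup.closure_induction with
  | zero => exact Submodule.zero_mem _
  | add a b _ _ ha hb => exact Submodule.add_mem _ ha hb
  | neg a _ ha => exact Submodule.neg_mem _ ha
  | mem z hz =>
    obtain ⟨_, ⟨a, -, _, ⟨r, hr, rfl⟩, rfl⟩, b, -, rfl⟩ := hz
    dsimp only
    induction a using PathAlgebra.induction with
    | zero => simp
    | add a a' h h' => rw [add_mul, add_mul]; exact Submodule.add_mem _ h h'
    | smul c p =>
    induction b using PathAlgebra.induction with
    | zero => simp
    | add a a' h h' => rw [mul_add]; exact Submodule.add_mem _ h h'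
    | smul c' q =>
    rw [mul_smul_comm, smul_mul_assoc, smul_mul_assoc]
    refine Submodule.smul_mem _ _ (Submodule.smul_mem _ _ ?_)
    rw [PathAlgebra.ofPath_mul, PathAlgebra.pathMul]
    split_ifs with h
    · rw [PathAlgebra.ofPath_mul, PathAlgebra.pathMul]
      split_ifs with h'
      · exact Submodule.subset_span ⟨_, hS p r q h h' hr, rfl⟩
      · exact Submodule.zero_mem _
    · rw [zero_mul]; exact Submodule.zero_mem _

theorem pathClass_eq_zero_of_mem {r : Q.Path} (hr : r ∈ R) : Q.pathClass k R r = 0 :=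
  Ideal.Quotient.eq_zero_iff_mem.2 (TwoSidedIdeal.subset_span ⟨r, hr, rfl⟩)

open Classical in
/-- The coordinates of an element of `kQ` at the paths that are nonzero in `A = kQ / I`. -/
def nonzeroPart (k : Type w) [Field k] (R : Set Q.Path) : Q.PathAlgebra k →ₗ[k] (Q.Path →₀ k) :=
  Finsupp.linearCombination k fun p => if Q.pathClass k R p = 0 then 0 else Finsupp.single p 1

open Classical in
theorem nonzeroPart_ofPath (p : Q.Path) : nonzeroPart k R (PathAlgebra.ofPath k p) =
    if Q.pathClass k R p = 0 then 0 else Finsupp.single p 1 := by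
  refine (Finsupp.linearCombination_single k 1 p).trans ?_
  rw [one_smul]

/-- A monomial ideal is spanned by the paths it contains, and `nonzeroPart` kills each of these.
Hence the coordinates descend to the quotient. -/
theorem nonzeroPart_eq_zero {x : Q.PathAlgebra k} (hx : x ∈ Q.pathIdeal k R) :
    nonzeroPart k R x = 0 := by
  have := mem_span_of_mem_pathIdeal (k := k) {p | Q.pathClass k R p = 0} (fun p r q h h' hr => by
    rw [Set.mem_ofPred_eq, ← pathClass_mul, ← pathClass_mul, pathClass_eq_zero_of_mem hr,
      mul_zero, zero_mul]) hx
  refine (Submodule.span_le.2 ?_ : _ ≤ LinearMap.ker (nonzeroPart k R)) this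
  rintro _ ⟨p, hp, rfl⟩
  exact (nonzeroPart_ofPath p).trans (if_pos hp)

/-- The coordinates of an element of `A = kQ / I` in the basis of nonzero paths. -/
def coeff (k : Type w) [Field k] (R : Set Q.Path) : Q.BoundAlgebra k R →ₗ[k] (Q.Path →₀ k) :=
  ((Q.pathIdeal k R).restrictScalars k).liftQ (nonzeroPart k R)
    (fun _ hx => nonzeroPart_eq_zero hx) ∘ₗ
    (Submodule.Quotient.restrictScalarsEquiv k (Q.pathIdeal k R)).symm.toLinearMap

open Classical in
theorem coeff_pathClass (p : Q.Path) : coeff k R (Q.pathClass k R p) =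
    if Q.pathClass k R p = 0 then 0 else Finsupp.single p 1 := nonzeroPart_ofPath p

theorem coeff_self {p : Q.Path} (hp : Q.pathClass k R p ≠ 0) :
    coeff k R (Q.pathClass k R p) p = 1 := by
  classical
  rw [coeff_pathClass, if_neg hp, Finsupp.single_eq_same]

theorem coeff_of_ne {p q : Q.Path} (h : p ≠ q) : coeff k R (Q.pathClass k R p) q = 0 := by
  classical
  rw [coeff_pathClass]
  split_ifs
  · rfl
  · exact Finsupp.single_eq_of_ne (Ne.symm h)

theorem linearCombination_coeff (x : Q.BoundAlgebra k R) :
    Finsupp.linearCombination k (Q.pathClass k R) (coeff k R x) = x := by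
  classical
  induction x using BoundAlgebra.induction with
  | zero => simp
  | add x y hx hy => rw [map_add, map_add, hx, hy]
  | smul c p =>
    rw [map_smul, map_smul, coeff_pathClass]
    split_ifs with h
    · rw [map_zero, h]
    · rw [Finsupp.linearCombination_single, one_smul]

theorem coeff_injective : Function.Injective (coeff k R) :=
  Function.LeftInverse.injective linearCombination_coeff

theorem coeff_eq_zero_of_pathClass {p : Q.Path} (hp : Q.pathClass k R p = 0)
    (x : Q.BoundAlgebra k R) : coeff k R x p = 0 := by
  induction x using BoundAlgebra.induction with
  | zero => simp
  | add x y hx hy => rw [map_add, Finsupp.add_apply, hx, hy, add_zero]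
  | smul c q =>
    rw [map_smul, Finsupp.smul_apply]
    by_cases h : q = p
    · rw [h, hp, map_zero]; simp
    · rw [coeff_of_ne h, smul_zero]

theorem eq_zero_of_coeff {x : Q.BoundAlgebra k R}
    (h : ∀ p, Q.pathClass k R p ≠ 0 → coeff k R x p = 0) : x = 0 := by
  refine coeff_injective ?_
  rw [map_zero]
  ext p
  by_cases hp : Q.pathClass k R p = 0
  · exact coeff_eq_zero_of_pathClass hp x
  · exact h p hp

/-- The basis of `A = kQ / I` formed by the paths outside of `I`. -/
def pathBasis (k : Type w) [Field k] (R : Set Q.Path) :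
    Module.Basis {p : Q.Path // Q.pathClass k R p ≠ 0} k (Q.BoundAlgebra k R) :=
  Module.Basis.mk (v := fun p => Q.pathClass k R p)
    (by
      -- Independence may be tested after applying `coeff`, which sends the classes to distinct
      -- standard basis vectors.
      refine LinearIndependent.of_comp (coeff k R) ?_
      have h : (coeff k R ∘ fun p : {p : Q.Path // Q.pathClass k R p ≠ 0} => Q.pathClass k R p) =
          fun p => Finsupp.single p.1 1 := by
        classical
        funext p
        rw [Function.comp_apply, coeff_pathClass, if_neg p.2]
      rw [h]
      exact (Finsupp.linearIndependent_single_one k Q.Path).comp _ Subtype.val_injective)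
    (by
      rintro x -
      induction x using BoundAlgebra.induction with
      | zero => exact Submodule.zero_mem _
      | add x y hx hy => exact Submodule.add_mem _ hx hy
      | smul c p =>
        refine Submodule.smul_mem _ _ ?_
        by_cases hp : Q.pathClass k R p = 0
        · rw [hp]; exact Submodule.zero_mem _
        · exact Submodule.subset_span ⟨⟨p, hp⟩, rfl⟩)

/-- The arrows `a` and `b` have a nonzero product in `A`. -/
def Follows (k : Type w) [Field k] (R : Set Q.Path) (a b : E) : Prop :=
  Q.arrowClass k R a * Q.arrowClass k R b ≠ 0

theorem Follows.tgt_eq {a b : E} (h : Follows k R a b) : Q.t a = Q.s b :=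
  (comp_of_mul_ne_zero h).1

/-- A path splits off its first arrow. -/
theorem pathClass_cons (x : V) (a : E) (l : List E) (h : Q.IsWalk x (a :: l)) :
    Q.pathClass k R ⟨x, a :: l, h⟩ = Q.arrowClass k R a * Q.pathClass k R ⟨Q.t a, l, h.2⟩ := by
  rw [arrowClass, pathClass_mul (Path.arrow Q a) ⟨Q.t a, l, h.2⟩ rfl]
  congr 1
  exact Path.ext h.1.symm rfl

theorem isChain_of_pathClass_ne_zero (l : List E) : ∀ (x : V) (h : Q.IsWalk x l),
    Q.pathClass k R ⟨x, l, h⟩ ≠ 0 → l.IsChain (Follows k R) := by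
  induction l with
  | nil => intros; exact List.isChain_nil
  | cons a l ih =>
    intro x h hne
    rw [pathClass_cons] at hne
    cases l with
    | nil => exact List.isChain_singleton _
    | cons b l =>
      refine List.isChain_cons_cons.2 ⟨?_, ih _ _ (right_ne_zero_of_mul hne)⟩
      rw [pathClass_cons, ← mul_assoc] at hne
      exact left_ne_zero_of_mul hne

/-- Every multiple of a generator contains two consecutive arrows with zero product, so the ideal
lies in the span of the paths that are not chains. The coordinate at a chain vanishes on that span
but not at the chain itself. -/
theorem pathClass_ne_zero_iff (hR : ∀ p ∈ R, p.length = 2) (p : Q.Path) :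
    Q.pathClass k R p ≠ 0 ↔ p.arrows.IsChain (Follows k R) := by
  refine ⟨isChain_of_pathClass_ne_zero _ _ _, fun hp h0 => ?_⟩
  have hmem := mem_span_of_mem_pathIdeal {p | ¬ p.arrows.IsChain (Follows k R)}
    (fun p r q h h' hr hc => ?_) (Ideal.Quotient.eq_zero_iff_mem.1 h0)
  · let φ : Q.PathAlgebra k →ₗ[k] k := (Finsupp.lapply p : (Q.Path →₀ k) →ₗ[k] k)
    have hφ := (Submodule.span_le.2 ?_ : _ ≤ LinearMap.ker φ) hmem
    · exact one_ne_zero ((Finsupp.single_eq_same (a := p) (b := (1 : k))).symm.trans hφ)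
    · rintro _ ⟨q, hq, rfl⟩
      refine (Finsupp.single_eq_of_ne ?_ : (Finsupp.single q (1 : k)) p = 0)
      rintro rfl
      exact hq hp
  · have hc' : r.arrows.IsChain (Follows k R) := hc.left_of_append.right_of_append
    have h2 := hR r hr
    have h0 := pathClass_eq_zero_of_mem (k := k) hr
    obtain ⟨x, l, hl⟩ := r
    obtain ⟨a, b, rfl⟩ := List.length_eq_two.1 h2
    refine (List.isChain_cons_cons.1 hc').1 ?_
    rw [arrowClass, arrowClass, pathClass_mul (Path.arrow Q a) (Path.arrow Q b) hl.2.1.symm, ← h0]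
    congr 1
    exact Path.ext hl.1 rfl

/-- With relations of length two, nonvanishing is a condition on adjacent arrows only, so nonzero
paths glue along a common piece. That piece must contain an arrow, since otherwise `p` and `r` would
meet directly. -/
theorem pathClass_comp_ne_zero (hR : ∀ p ∈ R, p.length = 2) {p q r : Q.Path}
    (h : p.tgt = q.src) (h' : q.tgt = r.src) (hq : 0 < q.length)
    (h1 : Q.pathClass k R p * Q.pathClass k R q ≠ 0)
    (h2 : Q.pathClass k R q * Q.pathClass k R r ≠ 0) :
    Q.pathClass k R p * Q.pathClass k R q * Q.pathClass k R r ≠ 0 := by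
  rw [pathClass_mul _ _ h, pathClass_ne_zero_iff hR] at h1
  rw [pathClass_mul _ _ h', pathClass_ne_zero_iff hR] at h2
  rw [pathClass_mul _ _ h, pathClass_mul _ _ ((Path.tgt_comp _ _ _).trans h'),
    pathClass_ne_zero_iff hR]
  exact List.IsChain.append_overlap h1 h2 (List.ne_nil_of_length_pos hq)

theorem pathClass_stationary_ne_zero (hR : ∀ p ∈ R, p.length = 2) (x : V) :
    Q.pathClass k R (Path.stationary Q x) ≠ 0 :=
  (pathClass_ne_zero_iff hR _).2 List.isChain_nil

theorem arrowClass_ne_zero (hR : ∀ p ∈ R, p.length = 2) (a : E) : Q.arrowClass k R a ≠ 0 :=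
  (pathClass_ne_zero_iff hR _).2 (List.isChain_singleton _)

end PathBasis

end ArrowQuiver

end

noncomputable section

namespace ArrowQuiver

/-! ### Prolongation of paths and finite maximal paths -/

section MaximalPaths

variable {k : Type w} [Field k] {V : Type u} {E : Type v} [Fintype V] {Q : ArrowQuiver V E}
  {R : Set Q.Path}

/-- Of two different continuations, exactly one is zero. This makes `Follows` a partial function. -/
theorem IsGentlePresentation.follows_right_unique (hA : Q.IsGentlePresentation k R) {a b b' : E}
    (h : Follows k R a b) (h' : Follows k R a b') : b = b' := by
  by_contra hne
  rcases hA.right_unique a b b' h.tgt_eq h'.tgt_eq hne with h0 | h0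
  exacts [h h0.1, h' h0.1]

theorem isWalk_of_isChain (l : List E) : ∀ a, (a :: l).IsChain (Follows k R) →
    Q.IsWalk (Q.s a) (a :: l) := by
  induction l with
  | nil => exact fun a _ => ⟨rfl, trivial⟩
  | cons b l ih =>
    intro a h
    rw [List.isChain_cons_cons] at h
    exact ⟨rfl, h.1.tgt_eq ▸ ih b h.2⟩

/-- A nonzero path that cannot be prolonged on the right is part of a finite maximal path. -/
theorem exists_isFiniteMaximalPath [Finite E] (hA : Q.IsGentlePresentation k R) {p : Q.Path}
    (hp : Q.pathClass k R p ≠ 0) (hmax : ∀ a, Q.pathClass k R p * Q.arrowClass k R a = 0) :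
    ∃ p, Q.IsFiniteMaximalPath k R p := by
  by_contra hno
  have key : ∀ p : Q.Path, Q.pathClass k R p ≠ 0 →
      (∀ a, Q.pathClass k R p * Q.arrowClass k R a = 0) →
      ∃ c, Q.arrowClass k R c * Q.pathClass k R p ≠ 0 := by
    intro p hp hmax
    by_contra! h
    exact hno ⟨p, hp, hmax, h⟩
  -- `T` collects the first arrows of the nonzero right maximal paths. If none of these paths is
  -- maximal on the left as well, each can be prolonged there, so every arrow in `T` has a
  -- predecessor in `T`.
  let T : Set E := {a | ∃ p : Q.Path, Q.pathClass k R p ≠ 0 ∧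
    (∀ c, Q.pathClass k R p * Q.arrowClass k R c = 0) ∧ ∃ l, p.arrows = a :: l}
  have hext : ∀ p : Q.Path, Q.pathClass k R p ≠ 0 →
      (∀ a, Q.pathClass k R p * Q.arrowClass k R a = 0) →
      ∃ c, ∃ q : Q.Path, Q.pathClass k R q ≠ 0 ∧
        (∀ a, Q.pathClass k R q * Q.arrowClass k R a = 0) ∧ q.arrows = c :: p.arrows := by
    intro p hp hmax
    obtain ⟨c, hc⟩ := key p hp hmax
    obtain ⟨h, hne⟩ := comp_of_mul_ne_zero (p := Path.arrow Q c) hc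
    refine ⟨c, (Path.arrow Q c).comp p h, hne, fun a => ?_, rfl⟩
    rw [← pathClass_mul, mul_assoc, hmax, mul_zero]
  have hpred : ∀ a : T, ∃ c : T, Follows k R c a := by
    rintro ⟨a, p, hp, hmax, l, hl⟩
    obtain ⟨c, q, hq, hqmax, hqa⟩ := hext p hp hmax
    refine ⟨⟨c, q, hq, hqmax, _, hqa⟩, ?_⟩
    rw [pathClass_ne_zero_iff hA.length_two, hqa, hl] at hq
    exact (List.isChain_cons_cons.1 hq).1
  choose f hf using hpred
  -- An arrow has at most one successor, so the chosen predecessor `f a` determines `a`. As `T` is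
  -- finite, `f` is also surjective: every arrow of `T` has a successor.
  have hinj : Function.Injective f := fun a b h =>
    Subtype.ext (hA.follows_right_unique (hf a) (h ▸ hf b))
  have hsurj := Finite.injective_iff_surjective.1 hinj
  -- The path `p` may be stationary; prolonging it once on the left guarantees that there is a last
  -- arrow.
  obtain ⟨c, q, hq, hqmax, hqa⟩ := hext p hp hmax
  obtain ⟨l, a, hla⟩ : ∃ l a, q.arrows = l ++ [a] :=
    ⟨_, _, (List.dropLast_append_getLast (by rw [hqa]; exact List.cons_ne_nil _ _)).symm⟩
  have hterm : ∀ d, ¬ Follows k R a d := by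
    intro d hd
    have ht : q.tgt = (Path.arrow Q d).src := by
      refine Eq.trans ?_ hd.tgt_eq
      change Q.endpoint q.src q.arrows = _
      rw [hla, endpoint_append]; rfl
    refine (pathClass_ne_zero_iff hA.length_two (q.comp _ ht)).2 ?_
      ((pathClass_mul _ _ ht).symm.trans (hqmax d))
    rw [pathClass_ne_zero_iff hA.length_two, hla] at hq
    change (q.arrows ++ [d]).IsChain _
    rw [hla]
    exact List.IsChain.append_overlap hq (List.isChain_pair.2 hd) (List.cons_ne_nil _ _)
  -- The last arrow `a` has no successor, so it is itself a right maximal path and lies in `T`,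
  -- where surjectivity of `f` gives it a successor.
  obtain ⟨b, hb⟩ := hsurj ⟨a, Path.arrow Q a, arrowClass_ne_zero hA.length_two a,
    fun d => not_not.1 (hterm d), _, rfl⟩
  exact hterm b (by simpa [hb] using hf b)

/-- Over a presentation without finite maximal paths, every nonzero path can be prolonged. -/
theorem exists_mul_arrowClass_ne_zero [Finite E] (hA : Q.IsGentlePresentation k R)
    (hno : ¬ ∃ p, Q.IsFiniteMaximalPath k R p) {p : Q.Path} (hp : Q.pathClass k R p ≠ 0) :
    ∃ a, Q.pathClass k R p * Q.arrowClass k R a ≠ 0 := by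
  by_contra! h
  exact hno (exists_isFiniteMaximalPath hA hp h)

end MaximalPaths

/-! ### Infinite dimension and cycles with nonzero square -/

section Cycles

theorem ofPath_injective {k : Type w} [Field k] {V : Type u} {E : Type v} {Q : ArrowQuiver V E} : Function.Injective (PathAlgebra.ofPath k : Q.Path → Q.PathAlgebra k) :=
  Finsupp.single_left_injective one_ne_zero

variable {k : Type w} [Field k] {V : Type u} {E : Type v} [Fintype V] {Q : ArrowQuiver V E}
  {R : Set Q.Path}

theorem finite_setOf_length_le [Finite E] (N : ℕ) : {p : Q.Path | p.length ≤ N}.Finite := by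
  refine Set.Finite.of_finite_image
    (f := fun p : Q.Path => (p.src, p.arrows)) ?_ (fun p _ q _ h => ?_)
  · refine (Set.finite_univ.prod (List.finite_length_le E N)).subset ?_
    rintro _ ⟨p, hp, rfl⟩
    exact ⟨trivial, hp⟩
  · exact Path.ext (congrArg Prod.fst h) (congrArg Prod.snd h)

theorem exists_lt_length [Finite E] (h : ¬ FiniteDimensional k (Q.BoundAlgebra k R)) (N : ℕ) :
    ∃ p : Q.Path, Q.pathClass k R p ≠ 0 ∧ N < p.length := by
  by_contra! hN
  have : Finite {p : Q.Path // Q.pathClass k R p ≠ 0} :=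
    ((finite_setOf_length_le N).subset fun p hp => hN p hp).to_subtype
  exact h (Module.Finite.of_basis (pathBasis k R))

theorem not_finiteDimensional_of_length
    (h : ∀ N : ℕ, ∃ p : Q.Path, Q.pathClass k R p ≠ 0 ∧ N ≤ p.length) :
    ¬ FiniteDimensional k (Q.BoundAlgebra k R) := by
  intro hfin
  have : Finite {p : Q.Path // Q.pathClass k R p ≠ 0} := Module.Finite.finite_basis (pathBasis k R)
  obtain ⟨N, hN⟩ := (Set.finite_range fun p : {p : Q.Path // Q.pathClass k R p ≠ 0} =>
    p.1.length).bddAbove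
  obtain ⟨p, hp, hl⟩ := h (N + 1)
  have : p.length ≤ N := hN ⟨⟨p, hp⟩, rfl⟩
  omega

/-- Prepending `c` to `q` keeps the invariant: the nonzero products `c * c` and `c * q` glue along
`c`. -/
theorem exists_long_multiple (hR : ∀ p ∈ R, p.length = 2) {c : Q.Path} (hc : c.src = c.tgt)
    (hpos : 0 < c.length) (hc2 : Q.pathClass k R c * Q.pathClass k R c ≠ 0) (N : ℕ) :
    ∃ q : Q.Path, Q.pathClass k R c * Q.pathClass k R q ≠ 0 ∧ N ≤ q.length := by
  induction N with
  | zero => exact ⟨c, hc2, Nat.zero_le _⟩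
  | succ N ih =>
    obtain ⟨q, hq, hN⟩ := ih
    obtain ⟨h, -⟩ := comp_of_mul_ne_zero hq
    refine ⟨c.comp q h, ?_, ?_⟩
    · rw [← pathClass_mul, ← mul_assoc]
      exact pathClass_comp_ne_zero hR hc.symm h hpos hc2 hq
    · change N + 1 ≤ (c.arrows ++ q.arrows).length
      rw [List.length_append]
      exact (Nat.add_le_add hN hpos).trans_eq (Nat.add_comm _ _)

theorem exists_append_of_not_nodup {α : Type*} {l : List α} (h : ¬ l.Nodup) :
    ∃ a l₁ l₂ l₃, l = l₁ ++ (a :: l₂ ++ a :: l₃) := by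
  induction l with
  | nil => exact absurd List.nodup_nil h
  | cons b l ih =>
    by_cases hb : b ∈ l
    · obtain ⟨l₂, l₃, rfl⟩ := List.append_of_mem hb
      exact ⟨b, [], l₂, l₃, rfl⟩
    · obtain ⟨a, l₁, l₂, l₃, rfl⟩ := ih fun hl => h (List.nodup_cons.2 ⟨hb, hl⟩)
      exact ⟨a, b :: l₁, l₂, l₃, rfl⟩

/-- By pigeonhole some arrow `a` occurs twice in `p`. The segment from the first occurrence up to
just before the second one is the closed path. -/
theorem exists_cycle [Fintype E] (hR : ∀ p ∈ R, p.length = 2) {p : Q.Path}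
    (hp : Q.pathClass k R p ≠ 0) (hl : Fintype.card E < p.length) :
    ∃ c : Q.Path, c.src = c.tgt ∧ 0 < c.length ∧
      Q.pathClass k R c * Q.pathClass k R c ≠ 0 := by
  have hnd : ¬ p.arrows.Nodup := fun h => absurd h.length_le_card (not_le.2 hl)
  obtain ⟨a, l₁, l₂, l₃, h⟩ := exists_append_of_not_nodup hnd
  rw [pathClass_ne_zero_iff hR, h] at hp
  have hch : (a :: (l₂ ++ [a])).IsChain (Follows k R) := by
    have := hp.right_of_append
    rw [show a :: l₂ ++ a :: l₃ = (a :: (l₂ ++ [a])) ++ l₃ by simp] at this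
    exact this.left_of_append
  have hw := (Q.isWalk_append _ (a :: l₂) [a]).1 (isWalk_of_isChain _ _ hch)
  have hcl : Q.s a = Q.endpoint (Q.s a) (a :: l₂) := hw.2.1
  let c : Q.Path := ⟨Q.s a, a :: l₂, hw.1⟩
  have hc : c.src = c.tgt := hcl
  refine ⟨c, hc, Nat.succ_pos _, ?_⟩
  rw [pathClass_mul _ _ hc.symm, pathClass_ne_zero_iff hR]
  change (a :: l₂ ++ ([a] ++ l₂)).IsChain _
  rw [← List.append_assoc]
  -- The square is obtained by gluing the chains `a l₂ a` and `a l₂` along the single arrow `a`.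
  exact List.IsChain.append_overlap (l₂ := [a]) hch
    (List.IsChain.left_of_append (l₂ := [a]) hch) (List.cons_ne_nil _ _)

theorem ofPath_pow {c : Q.Path} (hc : c.src = c.tgt) (n : ℕ) :
    ∃ q : Q.Path, PathAlgebra.ofPath k c ^ (n + 1) = PathAlgebra.ofPath k q ∧
      q.length = (n + 1) * c.length ∧ q.src = c.src := by
  induction n with
  | zero => exact ⟨c, pow_one _, (Nat.one_mul _).symm, rfl⟩
  | succ n ih =>
    obtain ⟨q, hq, hl, hs⟩ := ih
    have h : c.tgt = q.src := by rw [hs, hc]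
    refine ⟨c.comp q h, ?_, ?_, rfl⟩
    · rw [pow_succ', hq, PathAlgebra.ofPath_mul, PathAlgebra.pathMul, dif_pos h]
    · refine (List.length_append).trans ?_
      change c.length + q.length = _
      rw [hl]; ring

theorem hasInfiniteMaximalPath_iff [Fintype E] (hR : ∀ p ∈ R, p.length = 2) :
    Q.HasInfiniteMaximalPath k R ↔ ¬ FiniteDimensional k (Q.BoundAlgebra k R) := by
  constructor
  · rintro ⟨c, ⟨⟨hc, hpos, -⟩, -⟩, hc2⟩
    rw [sq] at hc2
    refine not_finiteDimensional_of_length fun N => ?_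
    obtain ⟨q, hq, hN⟩ := exists_long_multiple hR hc hpos hc2 N
    exact ⟨q, right_ne_zero_of_mul hq, hN⟩
  · intro h
    obtain ⟨p, hp, hl⟩ := exists_lt_length h (Fintype.card E)
    -- Primitivity comes from minimal length: if `c` were a proper power of `c'`, then `c'` would be
    -- a shorter closed path with nonzero square.
    obtain ⟨c, ⟨hc, hpos, hc2⟩, hmin⟩ := (measure Path.length).wf.has_min
      {c : Q.Path | c.src = c.tgt ∧ 0 < c.length ∧ Q.pathClass k R c * Q.pathClass k R c ≠ 0}
      (exists_cycle hR hp hl)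
    refine ⟨c, ⟨⟨hc, hpos, left_ne_zero_of_mul hc2⟩, ?_⟩, by rwa [sq]⟩
    rintro ⟨c', n, ⟨hc', hpos', hne'⟩, hn, hpow⟩
    obtain ⟨m, rfl⟩ : ∃ m, n = m + 2 := ⟨n - 2, by omega⟩
    have hcl : Q.pathClass k R c = Q.pathClass k R c' ^ (m + 2) := by
      rw [pathClass, hpow, map_pow]; rfl
    obtain ⟨q, hq, hl, -⟩ := ofPath_pow (k := k) hc' (m + 1)
    obtain rfl := ofPath_injective (hpow.trans hq)
    refine hmin c' ⟨hc', hpos', ?_⟩ (?_ : c'.length < c.length)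
    -- The square of `c'` is a right factor of the nonzero class `c = c' ^ (m + 2)`.
    · have := left_ne_zero_of_mul hc2
      rw [hcl, pow_add, sq] at this
      exact right_ne_zero_of_mul this
    · rw [hl]; nlinarith

end Cycles

end ArrowQuiver

end

noncomputable section

open Filter Topology

/-! ### Growth of generating subspaces in a general algebra -/

section Growth

variable {k : Type v} [Field k] {A : Type u} [Ring A] [Algebra k A]

/-- Padding with scalars turns products of at most `n` factors into products of exactly `n`, so the
lemmas on powers of submodules apply. -/
theorem growthSpace_eq_pow (V : Submodule k A) (n : ℕ) : growthSpace V n = (1 ⊔ V) ^ n := by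
  refine le_antisymm (iSup₂_le fun m hm => ?_) ?_
  · exact (pow_le_pow_left' le_sup_right m).trans (pow_le_pow_right' le_sup_left hm)
  · induction n with
    | zero => exact le_iSup₂_of_le (f := fun m (_ : m ≤ 0) => V ^ m) 0 le_rfl (by simp)
    | succ n ih =>
      rw [pow_succ, Submodule.mul_sup, mul_one]
      refine sup_le (ih.trans ?_) ((mul_le_mul_left ih V).trans ?_)
      · exact iSup₂_le fun m hm =>
          le_iSup₂_of_le (f := fun m (_ : m ≤ n + 1) => V ^ m) m (hm.trans n.le_succ) le_rfl
      · rw [growthSpace, Submodule.iSup_mul]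
        refine iSup_le fun m => ?_
        rw [Submodule.iSup_mul]
        refine iSup_le fun hm => ?_
        rw [← pow_succ]
        exact le_iSup₂_of_le (f := fun m (_ : m ≤ n + 1) => V ^ m) (m + 1)
          (Nat.succ_le_succ hm) le_rfl

theorem finiteDimensional_growthSpace (V : Submodule k A) [FiniteDimensional k V] (n : ℕ) :
    FiniteDimensional k (growthSpace V n) := by
  rw [growthSpace_eq_pow]
  refine Module.Finite.iff_fg.2 (Submodule.FG.pow (Submodule.FG.sup ?_ ?_) n)
  · rw [Submodule.one_eq_span]; exact Submodule.fg_span_singleton 1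
  · exact Module.Finite.iff_fg.1 ‹_›

/-- The filtration exhausts `A`. One repetition would make it constant from there on, and `A` would
be finite dimensional; hence the dimension goes up by at least one at each step, starting from a
positive value. -/
theorem lt_finrank_growthSpace (hA : ¬ FiniteDimensional k A) (V : Submodule k A)
    [FiniteDimensional k V] (hV : Algebra.adjoin k (V : Set A) = ⊤) (n : ℕ) :
    n < Module.finrank k (growthSpace V n) := by
  have hmono : Monotone fun n => (1 ⊔ V : Submodule k A) ^ n :=
    fun m n h => pow_le_pow_right' le_sup_left h
  have hex : ∀ x : A, ∃ m, x ∈ (1 ⊔ V : Submodule k A) ^ m := by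
    intro x
    have hx : x ∈ Algebra.adjoin k (V : Set A) := hV ▸ Algebra.mem_top
    induction hx using Algebra.adjoin_induction with
    | mem x hx => exact ⟨1, by rw [pow_one]; exact Submodule.mem_sup_right hx⟩
    | algebraMap r => exact ⟨0, by rw [pow_zero]; exact Submodule.algebraMap_mem r⟩
    | add x y _ _ hx hy =>
      obtain ⟨m, hm⟩ := hx
      obtain ⟨n, hn⟩ := hy
      exact ⟨max m n, add_mem (hmono (le_max_left _ _) hm) (hmono (le_max_right _ _) hn)⟩
    | mul x y _ _ hx hy =>
      obtain ⟨m, hm⟩ := hx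
      obtain ⟨n, hn⟩ := hy
      exact ⟨m + n, by rw [pow_add]; exact Submodule.mul_mem_mul hm hn⟩
  have hlt : ∀ n, (1 ⊔ V : Submodule k A) ^ n < (1 ⊔ V) ^ (n + 1) := by
    intro n
    refine lt_of_le_of_ne (hmono n.le_succ) fun heq => hA ?_
    have hstab : ∀ m, (1 ⊔ V : Submodule k A) ^ (n + m) = (1 ⊔ V) ^ n := by
      intro m
      induction m with
      | zero => rfl
      | succ m ih => rw [← add_assoc, pow_succ, ih, ← pow_succ, ← heq]
    have htop : growthSpace V n = ⊤ := by
      rw [growthSpace_eq_pow, eq_top_iff]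
      rintro x -
      obtain ⟨m, hm⟩ := hex x
      rw [← hstab m]
      exact hmono (Nat.le_add_left _ _) hm
    have := finiteDimensional_growthSpace V n
    rw [htop] at this
    exact Module.finite_def.2 (Module.Finite.iff_fg.1 this)
  induction n with
  | zero =>
    have := finiteDimensional_growthSpace V 0
    have hA' : Nontrivial A := by
      by_contra h
      rw [not_nontrivial_iff_subsingleton] at h
      exact hA inferInstance
    refine Module.finrank_pos_iff_exists_ne_zero.2 ⟨⟨1, ?_⟩, fun h => ?_⟩
    · rw [growthSpace_eq_pow, pow_zero]; exact Submodule.one_le.1 le_rfl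
    · exact one_ne_zero (congrArg Subtype.val h)
  | succ n ih =>
    have := finiteDimensional_growthSpace V (n + 1)
    refine lt_of_le_of_lt ih (Submodule.finrank_lt_finrank_of_lt ?_)
    rw [growthSpace_eq_pow, growthSpace_eq_pow]
    exact hlt n

/-- For `n ≥ 2` the quotient lies between `1` and `log D / log n + 1`, so the limit superior is a
limit. -/
theorem limsup_log_div_log_of_linear {d : ℕ → ℕ} {D : ℕ} (h1 : ∀ n, n < d n)
    (h2 : ∀ n, 1 ≤ n → d n ≤ D * n) :
    limsup (fun n : ℕ => ((Real.log (d n) / Real.log n : ℝ) : EReal)) atTop = 1 := by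
  refine Tendsto.limsup_eq ?_
  refine (continuous_coe_real_ereal.tendsto 1).comp ?_
  have hlog : Tendsto (fun n : ℕ => Real.log n) atTop atTop :=
    Real.tendsto_log_atTop.comp tendsto_natCast_atTop_atTop
  have hup : Tendsto (fun n : ℕ => Real.log D / Real.log n + 1) atTop (𝓝 1) := by
    simpa using (hlog.const_div_atTop (Real.log D)).add_const 1
  have hD : 0 < D := by
    have := (h1 1).trans_le (h2 1 le_rfl)
    omega
  refine tendsto_of_tendsto_of_tendsto_of_le_of_le' tendsto_const_nhds hup ?_ ?_
  · filter_upwards [eventually_ge_atTop 2] with n hn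
    have hn' : (1 : ℝ) < n := by exact_mod_cast hn
    rw [le_div_iff₀ (Real.log_pos hn'), one_mul]
    exact Real.log_le_log (by linarith) (by exact_mod_cast (h1 n).le)
  · filter_upwards [eventually_ge_atTop 2] with n hn
    have hn' : (1 : ℝ) < n := by exact_mod_cast hn
    have hpos := Real.log_pos hn'
    rw [div_add_one hpos.ne']
    refine div_le_div_of_nonneg_right ?_ hpos.le
    rw [← Real.log_mul (by positivity) (by positivity)]
    refine Real.log_le_log ?_ (by exact_mod_cast h2 n (by omega))
    exact_mod_cast (Nat.zero_le n).trans_lt (h1 n)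

theorem limsup_log_div_log_of_bounded {d : ℕ → ℕ} {D : ℕ} (h2 : ∀ n, d n ≤ D) :
    limsup (fun n : ℕ => ((Real.log (d n) / Real.log n : ℝ) : EReal)) atTop = 0 := by
  refine Tendsto.limsup_eq ?_
  refine (continuous_coe_real_ereal.tendsto 0).comp ?_
  have hlog : Tendsto (fun n : ℕ => Real.log n) atTop atTop :=
    Real.tendsto_log_atTop.comp tendsto_natCast_atTop_atTop
  refine tendsto_of_tendsto_of_tendsto_of_le_of_le tendsto_const_nhds
    (hlog.const_div_atTop (Real.log D)) (fun n => ?_) (fun n => ?_)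
  · exact div_nonneg (Real.log_natCast_nonneg _) (Real.log_natCast_nonneg _)
  · refine div_le_div_of_nonneg_right ?_ (Real.log_natCast_nonneg _)
    -- Here `Real.log 0 = 0` covers a vanishing `d n`. The bounds also hold for `n ≤ 1`, where the
    -- quotients are divisions by zero and equal `0`.
    rcases Nat.eq_zero_or_pos (d n) with h | h
    · rw [h]; simpa using Real.log_natCast_nonneg D
    · exact Real.log_le_log (by exact_mod_cast h) (by exact_mod_cast h2 n)

end Growth

namespace ArrowQuiver

/-! ### Counting nonzero paths and the Gelfand-Kirillov dimension -/

section GKDim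

variable {k : Type w} [Field k] {V : Type u} {E : Type v} [Fintype V] {Q : ArrowQuiver V E}
  {R : Set Q.Path}

/-- The span in `A` of the paths of length at most `n`. -/
def pathsUpTo (k : Type w) [Field k] (R : Set Q.Path) (n : ℕ) : Submodule k (Q.BoundAlgebra k R) :=
  Submodule.span k (Q.pathClass k R '' {p | p.length ≤ n})

theorem pathsUpTo_mono : Monotone (pathsUpTo k R) := fun _ _ h =>
  Submodule.span_mono (Set.image_mono fun _ hp => le_trans hp h)

theorem pathsUpTo_mul_le (m n : ℕ) :
    pathsUpTo k R m * pathsUpTo k R n ≤ pathsUpTo k R (m + n) := by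
  rw [pathsUpTo, pathsUpTo, Submodule.span_mul_span, Submodule.span_le]
  rintro _ ⟨_, ⟨p, hp, rfl⟩, _, ⟨q, hq, rfl⟩, rfl⟩
  dsimp only
  by_cases h : p.tgt = q.src
  · rw [pathClass_mul _ _ h]
    exact Submodule.subset_span ⟨_, (List.length_append).trans_le (Nat.add_le_add hp hq), rfl⟩
  · rw [pathClass_mul_of_ne _ _ h]
    exact Submodule.zero_mem _

theorem one_eq_sum_pathClass :
    (1 : Q.BoundAlgebra k R) = ∑ x, Q.pathClass k R (Path.stationary Q x) :=
  map_sum (Ideal.Quotient.mk (Q.pathIdeal k R)) _ _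

theorem one_le_pathsUpTo (n : ℕ) : 1 ≤ pathsUpTo k R n := by
  rw [Submodule.one_le, one_eq_sum_pathClass]
  exact Submodule.sum_mem _ fun x _ => Submodule.subset_span ⟨_, Nat.zero_le _, rfl⟩

theorem pathsUpTo_pow_le (m n : ℕ) : pathsUpTo k R m ^ n ≤ pathsUpTo k R (m * n) := by
  induction n with
  | zero => rw [pow_zero]; exact one_le_pathsUpTo _
  | succ n ih =>
    rw [pow_succ]
    exact (mul_le_mul_left ih _).trans (pathsUpTo_mul_le _ _)

theorem exists_mem_pathsUpTo (x : Q.BoundAlgebra k R) : ∃ n, x ∈ pathsUpTo k R n := by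
  induction x using BoundAlgebra.induction with
  | zero => exact ⟨0, Submodule.zero_mem _⟩
  | add x y hx hy =>
    obtain ⟨m, hm⟩ := hx
    obtain ⟨n, hn⟩ := hy
    exact ⟨max m n, add_mem (pathsUpTo_mono (le_max_left _ _) hm)
      (pathsUpTo_mono (le_max_right _ _) hn)⟩
  | smul c p => exact ⟨p.length, Submodule.smul_mem _ _ (Submodule.subset_span ⟨p, le_refl p.length, rfl⟩)⟩

theorem exists_le_pathsUpTo (W : Submodule k (Q.BoundAlgebra k R)) [FiniteDimensional k W] :
    ∃ n, W ≤ pathsUpTo k R n := by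
  obtain ⟨s, rfl⟩ := Module.Finite.iff_fg.1 (inferInstance : Module.Finite k W)
  choose f hf using exists_mem_pathsUpTo (k := k) (R := R)
  refine ⟨s.sup f, Submodule.span_le.2 fun x hx => ?_⟩
  exact pathsUpTo_mono (Finset.le_sup hx) (hf x)

/-- Each arrow of a chain determines the next one, so the first arrow and the length determine
everything. -/
theorem IsGentlePresentation.eq_of_isChain (hA : Q.IsGentlePresentation k R) (l : List E) :
    ∀ l' : List E, l.IsChain (Follows k R) → l'.IsChain (Follows k R) → l.head? = l'.head? →
      l.length = l'.length → l = l' := by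
  induction l with
  | nil => exact fun l' _ _ _ h => (List.length_eq_zero_iff.1 h.symm).symm
  | cons a l ih =>
    rintro (_ | ⟨a', l'⟩) h h' hh hl
    · exact absurd hl (Nat.succ_ne_zero _)
    obtain rfl : a = a' := by simpa using hh
    refine congrArg (a :: ·) (ih l' h.of_cons h'.of_cons ?_ (Nat.succ_injective hl))
    rcases l with _ | ⟨b, l⟩ <;> rcases l' with _ | ⟨b', l'⟩
    · rfl
    · exact absurd (Nat.succ_injective hl).symm (Nat.succ_ne_zero _)
    · exact absurd (Nat.succ_injective hl) (Nat.succ_ne_zero _)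
    · exact congrArg some (hA.follows_right_unique (List.isChain_cons_cons.1 h).1
        (List.isChain_cons_cons.1 h').1)

theorem pathsUpTo_eq_span (N : ℕ) : pathsUpTo k R N =
    Submodule.span k (Q.pathClass k R '' {p | Q.pathClass k R p ≠ 0 ∧ p.length ≤ N}) := by
  refine le_antisymm (Submodule.span_le.2 ?_) (Submodule.span_mono (Set.image_mono fun _ h => h.2))
  rintro _ ⟨p, hp, rfl⟩
  by_cases h : Q.pathClass k R p = 0
  · rw [h]; exact Submodule.zero_mem _
  · exact Submodule.subset_span ⟨p, ⟨h, hp⟩, rfl⟩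

theorem adjoin_pathsUpTo_one :
    Algebra.adjoin k (pathsUpTo k R 1 : Set (Q.BoundAlgebra k R)) = ⊤ := by
  have hpath : ∀ (l : List E) (x : V) (h : Q.IsWalk x l),
      Q.pathClass k R ⟨x, l, h⟩ ∈ Algebra.adjoin k (pathsUpTo k R 1 : Set (Q.BoundAlgebra k R)) := by
    intro l
    induction l with
    | nil =>
      exact fun x h => Algebra.subset_adjoin (Submodule.subset_span ⟨_, Nat.zero_le _, rfl⟩)
    | cons a l ih =>
      intro x h
      rw [pathClass_cons]
      exact mul_mem (Algebra.subset_adjoin (Submodule.subset_span ⟨Path.arrow Q a, le_refl 1, rfl⟩)) (ih _ _)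
  rw [Algebra.eq_top_iff]
  intro x
  induction x using BoundAlgebra.induction with
  | zero => exact zero_mem _
  | add x y hx hy => exact add_mem hx hy
  | smul c p => exact Subalgebra.smul_mem _ (hpath _ _ _) c

variable [Fintype E]

/-- The bound counts triples of source, optional first arrow and length, which separate nonzero
paths. The source is recorded to distinguish the stationary paths, which have no first arrow. -/
theorem IsGentlePresentation.ncard_le (hA : Q.IsGentlePresentation k R) (N : ℕ) :
    {p : Q.Path | Q.pathClass k R p ≠ 0 ∧ p.length ≤ N}.ncard ≤
      Fintype.card V * (Fintype.card E + 1) * (N + 1) := by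
  classical
  refine (Set.ncard_le_ncard_of_injOn (t := ((Finset.univ : Finset (V × Option E)) ×ˢ
    Finset.range (N + 1) : Finset _)) (fun p : Q.Path => ((p.src, p.arrows.head?), p.length))
    (fun p hp => ?_) (fun p hp q hq h => ?_) (Finset.finite_toSet _)).trans_eq ?_
  · simpa using Nat.lt_succ_of_le hp.2
  · simp only [Prod.mk.injEq] at h
    exact Path.ext h.1.1 (hA.eq_of_isChain _ _ ((pathClass_ne_zero_iff hA.length_two p).1 hp.1)
      ((pathClass_ne_zero_iff hA.length_two q).1 hq.1) h.1.2 h.2)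
  · rw [Set.ncard_coe_finset, Finset.card_product, Finset.card_univ, Fintype.card_prod,
      Fintype.card_option, Finset.card_range]

theorem finite_nonzero_paths (N : ℕ) :
    {p : Q.Path | Q.pathClass k R p ≠ 0 ∧ p.length ≤ N}.Finite :=
  (finite_setOf_length_le N).subset fun _ hp => hp.2

instance (N : ℕ) : FiniteDimensional k (pathsUpTo k R N) := by
  rw [pathsUpTo_eq_span]
  exact FiniteDimensional.span_of_finite k ((finite_nonzero_paths N).image _)

theorem IsGentlePresentation.finrank_pathsUpTo_le (hA : Q.IsGentlePresentation k R) (N : ℕ) :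
    Module.finrank k (pathsUpTo k R N) ≤ Fintype.card V * (Fintype.card E + 1) * (N + 1) := by
  classical
  have hfin := finite_nonzero_paths (k := k) (R := R) N
  refine le_trans ?_ (hA.ncard_le N)
  refine le_trans ?_ (Set.ncard_image_le (f := Q.pathClass k R) hfin)
  have := (hfin.image (Q.pathClass k R)).fintype
  rw [pathsUpTo_eq_span, Set.ncard_eq_toFinset_card']
  exact finrank_span_le_card _

theorem IsGentlePresentation.hasGKDim_one (hA : Q.IsGentlePresentation k R)
    (hinf : ¬ FiniteDimensional k (Q.BoundAlgebra k R)) : HasGKDim k (Q.BoundAlgebra k R) 1 := by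
  refine ⟨⟨pathsUpTo k R 1, inferInstance, adjoin_pathsUpTo_one⟩, fun W hW hgen => ?_⟩
  obtain ⟨m, hm⟩ := exists_le_pathsUpTo W
  refine limsup_log_div_log_of_linear
    -- As `W` lies in the span of the paths of length at most `m`, its `n`-th growth space lies in
    -- that of length at most `m * n`. The constant then comes from `m * n + 1 ≤ (m + 1) * n` for `n
    -- ≥ 1`.
    (D := Fintype.card V * (Fintype.card E + 1) * (m + 1))
    (fun n => lt_finrank_growthSpace hinf W hgen n) fun n hn => ?_
  have hle : growthSpace W n ≤ pathsUpTo k R (m * n) := by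
    rw [growthSpace_eq_pow]
    exact (pow_le_pow_left' (sup_le (one_le_pathsUpTo m) hm) n).trans (pathsUpTo_pow_le m n)
  refine ((Submodule.finrank_mono hle).trans (hA.finrank_pathsUpTo_le _)).trans ?_
  rw [mul_assoc _ (m + 1) n]
  exact Nat.mul_le_mul_left _ (by nlinarith)

theorem hasGKDim_zero (hfin : FiniteDimensional k (Q.BoundAlgebra k R)) :
    HasGKDim k (Q.BoundAlgebra k R) 0 :=
  ⟨⟨pathsUpTo k R 1, inferInstance, adjoin_pathsUpTo_one⟩, fun W _ _ =>
    limsup_log_div_log_of_bounded fun n => Submodule.finrank_le (growthSpace W n)⟩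

end GKDim

end ArrowQuiver

end

noncomputable section

namespace GrModR

/-! ### Graded radical and graded Ext in degrees zero and one, for a general graded algebra -/

section RadicalAndExt

variable {k : Type v} [Field k] {A : Type u} [Ring A] [Algebra k A] (𝒜 : ℕ → Submodule k A)
  [GradedAlgebra 𝒜]

/-- The elements of positive degree lie in the graded Jacobson radical. -/
theorem mem_gradedRadical_of_decompose_zero {x : A}
    (hx : (DirectSum.decompose 𝒜 x 0 : A) = 0) : x ∈ gradedRadical 𝒜 := by
  rw [gradedRadical, Submodule.mem_sInf]
  intro K hK
  let π := GradedRing.projZeroRingHom 𝒜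
  have hπ : ∀ y, π y = (DirectSum.decompose 𝒜 y 0 : A) := GradedRing.projZeroRingHom_apply 𝒜
  -- `L` is the preimage of `K` under the ring homomorphism `π` onto degree zero. It is a proper
  -- homogeneous right ideal containing `K`, so maximality forces `L ≤ K`, and `x` lies in `L`
  -- because `π x = 0`.
  let L : Submodule Aᵐᵒᵖ A :=
    { carrier := {y | π y ∈ K}
      add_mem' := fun {a b} ha hb => by
        change π (a + b) ∈ K
        rw [map_add]; exact K.add_mem ha hb
      zero_mem' := by
        change π 0 ∈ K
        rw [map_zero]; exact K.zero_mem
      smul_mem' := fun c y hy => by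
        change π (y * c.unop) ∈ K
        rw [map_mul]
        exact K.smul_mem (MulOpposite.op (π c.unop)) hy }
  have hL : L.IsHomogeneous 𝒜 ∧ L ≠ ⊤ := by
    refine ⟨fun i y hy => ?_, fun h => hK.1.2 ?_⟩
    · change π _ ∈ K
      rw [hπ]
      by_cases hi : i = 0
      · subst hi
        rw [DirectSum.decompose_of_mem_same 𝒜 (SetLike.coe_mem _), ← hπ]
        exact hy
      · rw [DirectSum.decompose_of_mem_ne 𝒜 (SetLike.coe_mem _) hi]
        exact K.zero_mem
    · have h1 : π 1 ∈ K := (h ▸ Submodule.mem_top : (1 : A) ∈ L)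
      rw [map_one] at h1
      rw [eq_top_iff]
      rintro y -
      have := K.smul_mem (MulOpposite.op y) h1
      rwa [op_smul_eq_mul, one_mul] at this
  have hKL : K ≤ L := fun y hy => by
    change π y ∈ K
    rw [hπ]
    exact hK.1.1 0 hy
  refine hK.2 hL hKL ?_
  change π x ∈ K
  rw [hπ, hx]
  exact K.zero_mem

/-- A graded homomorphism `S → A` is the left multiplication by an element killed by the radical. -/
theorem exists_mul_eq_zero_of_nontrivial_grExt_zero
    (h : Nontrivial (grExt (top 𝒜) (self 𝒜) 0)) :
    ∃ m : A, m ≠ 0 ∧ ∀ a ∈ gradedRadical 𝒜, m * a = 0 := by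
  obtain ⟨z, hz⟩ := exists_ne (0 : grExt (top 𝒜) (self 𝒜) 0)
  obtain ⟨d, hd⟩ : ∃ d, z d ≠ 0 := by
    by_contra! h
    exact hz (DFinsupp.ext h)
  let f : top 𝒜 ⟶ (self 𝒜).shift d := Abelian.Ext.addEquiv₀ (z d)
  have hf : f ≠ 0 := fun h => hd (Abelian.Ext.addEquiv₀.map_eq_zero_iff.1 h)
  -- Pulled back to `A`, the map `f` becomes right linear on a free module of rank one, hence left
  -- multiplication by the image of `1`.
  let g : A →ₗ[Aᵐᵒᵖ] A := LinearMap.comp (M₂ := A ⧸ gradedRadical 𝒜) (lin f)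
    (gradedRadical 𝒜).mkQ
  have hg : ∀ x, g x = g 1 * x := by
    intro x
    have := g.map_smul (MulOpposite.op x) 1
    rwa [op_smul_eq_mul, one_mul] at this
  refine ⟨g 1, fun h1 => hf (hom_ext fun y => ?_), fun a ha => ?_⟩
  · obtain ⟨x, rfl⟩ := (gradedRadical 𝒜).mkQ_surjective y
    exact (hg x).trans (by rw [h1, zero_mul]; rfl)
  · rw [← hg]
    have h0 : (gradedRadical 𝒜).mkQ a = 0 := (Submodule.Quotient.mk_eq_zero _).2 ha
    exact (congrArg (lin f) h0).trans (map_zero (lin f))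

/-- Left multiplication by `m` as a map of right modules. -/
def mulLeftR (m : A) : A →ₗ[Aᵐᵒᵖ] A where
  toFun x := m * x
  map_add' := mul_add m
  map_smul' c x := (mul_assoc m x c.unop).symm

/-- Left multiplication by `m` factors through `S` because `m` kills the radical, and `hdeg` makes
it a degree-preserving map to the shift by `n`. -/
theorem nontrivial_grExt_zero (m : A) (n : ℕ) (hm : m ≠ 0)
    (hdeg : ∀ (i : ℤ) (x : A), x ∈ selfDeg 𝒜 i → m * x ∈ selfDeg 𝒜 (i + n))
    (h : ∀ a ∈ gradedRadical 𝒜, m * a = 0) : Nontrivial (grExt (top 𝒜) (self 𝒜) 0) := by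
  let f : top 𝒜 ⟶ (self 𝒜).shift n :=
    ofLin (M := top 𝒜) (N := (self 𝒜).shift n) ((gradedRadical 𝒜).liftQ (mulLeftR m) h) (by
      rintro i _ ⟨x, hx, rfl⟩
      exact hdeg i x hx)
  have hf : f ≠ 0 := by
    intro h0
    have h1 : m * 1 = 0 := LinearMap.congr_fun (congrArg lin h0) ((gradedRadical 𝒜).mkQ 1)
    exact hm (by rwa [mul_one] at h1)
  have : Nontrivial (Abelian.Ext (top 𝒜) ((self 𝒜).shift n) 0) :=
    ⟨⟨_, _, fun h0 => hf (Abelian.Ext.addEquiv₀.symm.map_eq_zero_iff.1 h0)⟩⟩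
  exact (DirectSum.of_injective (β := fun d : ℤ => Abelian.Ext (top 𝒜) ((self 𝒜).shift d) 0)
    (n : ℤ)).nontrivial

/-- The inclusion of the graded radical. -/
def radicalι : (self 𝒜).sub (gradedRadical 𝒜) (gradedRadical_homogeneous 𝒜) ⟶ self 𝒜 :=
  ofLin (gradedRadical 𝒜).subtype fun _ _ h => h

/-- The projection from `A` to `S`. -/
def topπ : self 𝒜 ⟶ top 𝒜 := ofLin (gradedRadical 𝒜).mkQ fun _ x h => ⟨x, h, rfl⟩

theorem radicalι_topπ : radicalι 𝒜 ≫ topπ 𝒜 = 0 :=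
  hom_ext fun x => (Submodule.Quotient.mk_eq_zero _).2 x.2

theorem radical_shortExact :
    (ShortComplex.mk (radicalι 𝒜) (topπ 𝒜) (radicalι_topπ 𝒜)).ShortExact where
  exact := ShortComplex.exact_of_f_is_kernel _
    (isLimitOfExact (radicalι 𝒜) (topπ 𝒜) Subtype.val_injective (radicalι_topπ 𝒜)
      fun y hy => ⟨⟨y, (Submodule.Quotient.mk_eq_zero _).1 hy⟩, rfl⟩)
  mono_f := ⟨fun g h hgh => hom_ext fun x =>
    Subtype.ext (LinearMap.congr_fun (congrArg lin hgh) x)⟩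
  epi_g := ⟨fun g h hgh => hom_ext fun y => by
    obtain ⟨x, rfl⟩ := (gradedRadical 𝒜).mkQ_surjective y
    exact LinearMap.congr_fun (congrArg lin hgh) x⟩

/-- A graded homomorphism from the radical to `A` that is not a left multiplication gives a nonzero
class in `grExt^1(S, A)`. -/
theorem nontrivial_grExt_one (d : ℤ) (f : gradedRadical 𝒜 →ₗ[Aᵐᵒᵖ] A)
    (hdeg : ∀ (i : ℤ) (x : gradedRadical 𝒜), (x : A) ∈ selfDeg 𝒜 i → f x ∈ selfDeg 𝒜 (i + d))
    (hf : ∀ m : A, ∃ x, f x ≠ m * x) : Nontrivial (grExt (top 𝒜) (self 𝒜) 1) := by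
  have : Nontrivial (Abelian.Ext (top 𝒜) ((self 𝒜).shift d) 1) := by
    by_contra hsub
    rw [not_nontrivial_iff_subsingleton] at hsub
    let F : (self 𝒜).sub (gradedRadical 𝒜) (gradedRadical_homogeneous 𝒜) ⟶ (self 𝒜).shift d :=
      ofLin (M := (self 𝒜).sub (gradedRadical 𝒜) (gradedRadical_homogeneous 𝒜))
        (N := (self 𝒜).shift d) f hdeg
    -- If the first Ext group vanished, the long exact sequence would extend `F` from the radical to
    -- all of `A`, where every right linear map is a left multiplication.
    obtain ⟨G, hG⟩ := Abelian.Ext.contravariant_sequence_exact₁ (radical_shortExact 𝒜) _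
      (Abelian.Ext.mk₀ F) (add_zero 1) (Subsingleton.elim _ _)
    obtain ⟨g, rfl⟩ := Abelian.Ext.addEquiv₀.symm.surjective G
    have hg : radicalι 𝒜 ≫ g = F := by
      refine Abelian.Ext.addEquiv₀.symm.injective ?_
      exact (Abelian.Ext.mk₀_comp_mk₀ _ _).symm.trans hG
    let g' : A →ₗ[Aᵐᵒᵖ] A := lin g
    obtain ⟨x, hx⟩ := hf (g' 1)
    refine hx ?_
    have h1 : g' (x : A) = f x := LinearMap.congr_fun (congrArg lin hg) x
    have h2 := g'.map_smul (MulOpposite.op (x : A)) 1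
    rw [op_smul_eq_mul, one_mul, h1] at h2
    exact h2
  exact (DirectSum.of_injective (β := fun d : ℤ => Abelian.Ext (top 𝒜) ((self 𝒜).shift d) 1)
    d).nontrivial

theorem gradedDepth_eq_zero_iff :
    gradedDepth 𝒜 = 0 ↔ Nontrivial (grExt (top 𝒜) (self 𝒜) 0) := by
  constructor
  · intro h
    by_contra h0
    have : (1 : ℕ∞) ≤ gradedDepth 𝒜 := by
      refine le_iInf₂ fun j hj => ?_
      rcases j with _ | j
      · exact absurd hj h0
      · exact_mod_cast Nat.succ_le_succ (Nat.zero_le j)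
    rw [h] at this
    exact absurd this (by simp)
  · exact fun h => le_antisymm (iInf₂_le 0 h) zero_le

end RadicalAndExt

end GrModR

end

noncomputable section

open GrModR

namespace ArrowQuiver

/-! ### Graded radical of a path algebra with relations, and depth zero -/

section Depth

theorem eq_stationary_of_length {V : Type u} {E : Type v} {Q : ArrowQuiver V E} {p : Q.Path} (h : p.length = 0) :
    p = Path.stationary Q p.src :=
  Path.ext rfl (List.length_eq_zero_iff.1 h)

variable {k : Type w} [Field k] {V : Type u} {E : Type v} [Fintype V] {Q : ArrowQuiver V E}
  {R : Set Q.Path}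

theorem eq_sum_coeff (x : Q.BoundAlgebra k R) :
    x = ∑ p ∈ (coeff k R x).support, coeff k R x p • Q.pathClass k R p :=
  (linearCombination_coeff x).symm.trans (Finsupp.linearCombination_apply _ _)

theorem pathClass_mem_grading (p : Q.Path) : Q.pathClass k R p ∈ Q.grading k R p.length :=
  ⟨_, ofPath_mem_pathDeg k p, rfl⟩

theorem coeff_of_mem_grading {n : ℕ} {x : Q.BoundAlgebra k R} (hx : x ∈ Q.grading k R n)
    {p : Q.Path} (hp : p.length ≠ n) : coeff k R x p = 0 := by
  obtain ⟨y, hy, rfl⟩ := hx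
  refine (Submodule.span_le.2 ?_ : Q.pathDeg k n ≤ LinearMap.ker (Finsupp.lapply p ∘ₗ coeff k R ∘ₗ
    (Ideal.Quotient.mkₐ k (Q.pathIdeal k R)).toLinearMap)) hy
  rintro _ ⟨q, rfl, rfl⟩
  exact coeff_of_ne fun h => hp (congrArg Path.length h.symm)

theorem coeff_decompose (x : Q.BoundAlgebra k R) (i : ℕ) {p : Q.Path} (hp : p.length = i) :
    coeff k R (DirectSum.decompose (Q.grading k R) x i) p = coeff k R x p := by
  subst hp
  induction x using BoundAlgebra.induction with
  | zero => simp
  | add x y hx hy =>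
    rw [DirectSum.decompose_add, DirectSum.add_apply, Submodule.coe_add, map_add, map_add,
      Finsupp.add_apply, Finsupp.add_apply, hx, hy]
  | smul c q =>
    rw [DirectSum.decompose_smul, DirectSum.smul_apply, Submodule.coe_smul, map_smul, map_smul,
      Finsupp.smul_apply, Finsupp.smul_apply]
    congr 1
    by_cases h : q.length = p.length
    · rw [DirectSum.decompose_of_mem_same (Q.grading k R) (h ▸ pathClass_mem_grading q)]
    · rw [DirectSum.decompose_of_mem_ne (Q.grading k R) (pathClass_mem_grading q) h, map_zero,
        coeff_of_ne fun h' => h (congrArg Path.length h')]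
      rfl

theorem mem_selfDeg_iff {x : Q.BoundAlgebra k R} {i : ℤ} :
    x ∈ selfDeg (Q.grading k R) i ↔ ∀ p, coeff k R x p ≠ 0 → (p.length : ℤ) = i := by
  constructor
  · intro hx p hp
    rcases i with n | n
    · by_contra h
      exact hp (coeff_of_mem_grading (n := n) hx fun h' => h (congrArg Int.ofNat h'))
    · rw [show x = 0 from hx, map_zero] at hp
      exact absurd rfl hp
  · intro h
    rcases i with n | n
    · change x ∈ Q.grading k R n
      rw [eq_sum_coeff x]
      refine Submodule.sum_mem _ fun p hp => Submodule.smul_mem _ _ ?_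
      have : p.length = n := Int.ofNat_injective (h p (Finsupp.mem_support_iff.1 hp))
      exact this ▸ pathClass_mem_grading p
    · refine eq_zero_of_coeff fun p _ => ?_
      by_contra hp
      exact absurd (h p hp) (by omega)

theorem smul_mem_selfDeg {x : Q.BoundAlgebra k R} {i : ℤ} (hx : x ∈ selfDeg (Q.grading k R) i)
    (c : k) : c • x ∈ selfDeg (Q.grading k R) i := by
  rw [mem_selfDeg_iff] at hx ⊢
  intro p hp
  rw [map_smul, Finsupp.smul_apply, smul_eq_mul] at hp
  exact hx p (right_ne_zero_of_mul hp)

theorem pathClass_mul_mem_selfDeg (p q : Q.Path) :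
    Q.pathClass k R p * Q.pathClass k R q ∈ selfDeg (Q.grading k R) (p.length + q.length) :=
  SetLike.GradedMul.mul_mem (A := Q.grading k R) (pathClass_mem_grading p) (pathClass_mem_grading q)

/-- The coefficient of a prolongation by an arrow. -/
theorem coeff_mul_arrowClass (m : Q.BoundAlgebra k R) (a : E) (p : Q.Path)
    (h : p.tgt = (Path.arrow Q a).src) (hp : Q.pathClass k R (p.comp _ h) ≠ 0) :
    coeff k R (m * Q.arrowClass k R a) (p.comp _ h) = coeff k R m p := by
  induction m using BoundAlgebra.induction with
  | zero => simp
  | add x y hx hy => rw [add_mul, map_add, map_add, Finsupp.add_apply, Finsupp.add_apply, hx, hy]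
  | smul c r =>
    rw [smul_mul_assoc, map_smul, map_smul, Finsupp.smul_apply, Finsupp.smul_apply, arrowClass]
    congr 1
    by_cases hrp : r = p
    · subst hrp
      rw [pathClass_mul _ _ h, coeff_self hp, coeff_self]
      rw [← pathClass_mul] at hp
      exact left_ne_zero_of_mul hp
    · rw [coeff_of_ne hrp]
      by_cases hr : r.tgt = (Path.arrow Q a).src
      · rw [pathClass_mul _ _ hr]
        refine coeff_of_ne fun heq => hrp (Path.ext (congrArg Path.src heq :) ?_)
        exact List.append_cancel_right (congrArg Path.arrows heq)
      · rw [pathClass_mul_of_ne _ _ hr, map_zero]; rfl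

/-- A concatenation is stationary only if both factors are. So the coordinate at a stationary path
is a character of `A`; its kernel is one of the maximal homogeneous right ideals. -/
theorem coeff_stationary_mul (hR : ∀ p ∈ R, p.length = 2) (x y : Q.BoundAlgebra k R) (v : V) :
    coeff k R (x * y) (Path.stationary Q v) =
      coeff k R x (Path.stationary Q v) * coeff k R y (Path.stationary Q v) := by
  induction x using BoundAlgebra.induction with
  | zero => simp
  | add x x' hx hx' =>
    rw [add_mul, map_add, map_add, Finsupp.add_apply, Finsupp.add_apply, hx, hx', add_mul]
  | smul c p =>
  induction y using BoundAlgebra.induction with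
  | zero => simp
  | add x x' hx hx' =>
    rw [mul_add, map_add, map_add, Finsupp.add_apply, Finsupp.add_apply, hx, hx', mul_add]
  | smul c' q =>
    simp only [smul_mul_assoc, mul_smul_comm, map_smul, Finsupp.smul_apply, smul_eq_mul,
      mul_assoc, mul_left_comm _ c']
    congr 2
    by_cases hpq : p = Path.stationary Q v ∧ q = Path.stationary Q v
    · obtain ⟨rfl, rfl⟩ := hpq
      rw [pathClass_mul (Path.stationary Q v) (Path.stationary Q v) rfl]
      have := coeff_self (pathClass_stationary_ne_zero (k := k) hR v)
      rw [this, one_mul]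
      exact this
    · have hr : coeff k R (Q.pathClass k R p) (Path.stationary Q v) *
          coeff k R (Q.pathClass k R q) (Path.stationary Q v) = 0 := by
        by_cases hp : p = Path.stationary Q v
        · rw [coeff_of_ne (fun hq => hpq ⟨hp, hq⟩), mul_zero]
        · rw [coeff_of_ne hp, zero_mul]
      rw [hr]
      by_cases h : p.tgt = q.src
      · rw [pathClass_mul _ _ h]
        refine coeff_of_ne fun heq => hpq ?_
        have harr : p.arrows ++ q.arrows = [] := congrArg Path.arrows heq
        rw [List.append_eq_nil_iff] at harr
        have hp : p = Path.stationary Q v := Path.ext (congrArg Path.src heq :) harr.1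
        exact ⟨hp, Path.ext (by rw [← h, hp]; rfl) harr.2⟩
      · rw [pathClass_mul_of_ne _ _ h, map_zero]; rfl

theorem coeff_stationary_one (hR : ∀ p ∈ R, p.length = 2) (v : V) :
    coeff k R 1 (Path.stationary Q v) = 1 := by
  rw [one_eq_sum_pathClass, map_sum, Finsupp.finsetSum_apply, Finset.sum_eq_single v]
  · exact coeff_self (pathClass_stationary_ne_zero hR v)
  · exact fun x _ hx => coeff_of_ne fun h => hx (congrArg Path.src h)
  · exact fun h => absurd (Finset.mem_univ _) h

/-- The graded radical consists of the combinations of paths of positive length. -/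
theorem mem_gradedRadical_iff (hR : ∀ p ∈ R, p.length = 2) (x : Q.BoundAlgebra k R) :
    x ∈ gradedRadical (Q.grading k R) ↔ ∀ v, coeff k R x (Path.stationary Q v) = 0 := by
  constructor
  · intro hx v
    let K : Submodule (Q.BoundAlgebra k R)ᵐᵒᵖ (Q.BoundAlgebra k R) :=
      { carrier := {y | coeff k R y (Path.stationary Q v) = 0}
        add_mem' := fun {a b} ha hb => by
          change coeff k R (a + b) _ = 0
          rw [map_add, Finsupp.add_apply, show coeff k R a _ = 0 from ha,
            show coeff k R b _ = 0 from hb, add_zero]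
        zero_mem' := by
          change coeff k R 0 _ = 0
          rw [map_zero]; rfl
        smul_mem' := fun c y hy => by
          change coeff k R (y * c.unop) _ = 0
          rw [coeff_stationary_mul hR, show coeff k R y _ = 0 from hy, zero_mul] }
    have hK : Maximal (fun K : Submodule (Q.BoundAlgebra k R)ᵐᵒᵖ (Q.BoundAlgebra k R) =>
        K.IsHomogeneous (Q.grading k R) ∧ K ≠ ⊤) K := by
      refine ⟨⟨fun i y hy => ?_, fun h => ?_⟩, fun L hL hKL y hy => ?_⟩
      · change coeff k R _ _ = 0
        by_cases hi : i = 0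
        · subst hi
          exact (coeff_decompose y 0 rfl).trans hy
        · exact coeff_of_mem_grading (SetLike.coe_mem _) (Ne.symm hi)
      · have : (1 : Q.BoundAlgebra k R) ∈ K := h ▸ Submodule.mem_top
        exact one_ne_zero ((coeff_stationary_one hR v).symm.trans this)
      · by_contra hne
        have hne' : coeff k R y (Path.stationary Q v) ≠ 0 := hne
        refine hL.2 (eq_top_iff.2 fun z _ => ?_)
        -- An element `y` outside the kernel `K` has invertible coordinate at `v`, so any `z` agrees
        -- modulo `K` with a right multiple of `y`.
        have hz : z - y * ((coeff k R y (Path.stationary Q v))⁻¹ • z) ∈ K := by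
          change coeff k R _ _ = 0
          rw [map_sub, Finsupp.sub_apply, coeff_stationary_mul hR, map_smul, Finsupp.smul_apply,
            smul_eq_mul, mul_inv_cancel_left₀ hne', sub_self]
        have := L.add_mem (hKL hz)
          (L.smul_mem (MulOpposite.op ((coeff k R y (Path.stationary Q v))⁻¹ • z)) hy)
        rwa [op_smul_eq_mul, sub_add_cancel] at this
    rw [gradedRadical, Submodule.mem_sInf] at hx
    exact hx K hK
  · intro hx
    refine mem_gradedRadical_of_decompose_zero _ (eq_zero_of_coeff fun p _ => ?_)
    by_cases hp : p.length = 0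
    · rw [coeff_decompose x 0 hp, eq_stationary_of_length hp, hx]
    · exact coeff_of_mem_grading (SetLike.coe_mem _) hp

theorem pathClass_mem_gradedRadical (hR : ∀ p ∈ R, p.length = 2) {p : Q.Path} (hp : 0 < p.length) :
    Q.pathClass k R p ∈ gradedRadical (Q.grading k R) := by
  rw [mem_gradedRadical_iff hR]
  exact fun v => coeff_of_ne fun h => by rw [h] at hp; exact absurd hp (lt_irrefl 0)

theorem length_pos_of_mem_gradedRadical (hR : ∀ p ∈ R, p.length = 2) {x : Q.BoundAlgebra k R}
    (hx : x ∈ gradedRadical (Q.grading k R)) {p : Q.Path} (hp : p ∈ (coeff k R x).support) :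
    0 < p.length := by
  rw [mem_gradedRadical_iff hR] at hx
  refine Nat.pos_of_ne_zero fun h => Finsupp.mem_support_iff.1 hp ?_
  rw [eq_stationary_of_length h, hx]

theorem pathClass_mul_eq_zero {x : Q.BoundAlgebra k R} (h : ∀ a, x * Q.arrowClass k R a = 0)
    {q : Q.Path} (hq : 0 < q.length) : x * Q.pathClass k R q = 0 := by
  obtain ⟨y, _ | ⟨a, l⟩, hl⟩ := q
  · exact absurd hq (lt_irrefl 0)
  · rw [pathClass_cons, ← mul_assoc, h, zero_mul]

/-- Degree zero Ext is governed by elements killed by the radical on the right. This only sees right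
maximality; `exists_isFiniteMaximalPath` supplies the other side. -/
theorem IsGentlePresentation.gradedDepth_eq_zero_iff [Finite E]
    (hA : Q.IsGentlePresentation k R) :
    gradedDepth (Q.grading k R) = 0 ↔ ∃ p, Q.IsFiniteMaximalPath k R p := by
  have hR := hA.length_two
  rw [GrModR.gradedDepth_eq_zero_iff]
  constructor
  · intro h
    obtain ⟨m, hm, hmJ⟩ := exists_mul_eq_zero_of_nontrivial_grExt_zero _ h
    obtain ⟨p, hp, hmp⟩ : ∃ p, Q.pathClass k R p ≠ 0 ∧ coeff k R m p ≠ 0 := by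
      by_contra! h
      exact hm (eq_zero_of_coeff h)
    -- A path `p` in the support of `m` is right maximal: if `p * a ≠ 0`, then `m * a` has at `pa`
    -- the coordinate of `m` at `p`, yet `m * a = 0`.
    refine exists_isFiniteMaximalPath hA hp fun a => ?_
    by_contra hne
    obtain ⟨ht, hc⟩ := comp_of_mul_ne_zero hne
    refine hmp ?_
    rw [← coeff_mul_arrowClass m a p ht hc,
      hmJ (Q.arrowClass k R a) (pathClass_mem_gradedRadical hR (p := Path.arrow Q a) Nat.one_pos),
      map_zero]
    rfl
  · rintro ⟨p, hp, hright, -⟩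
    refine nontrivial_grExt_zero _ (Q.pathClass k R p) p.length hp (fun i x hx => ?_)
      fun x hx => ?_
    · rw [mem_selfDeg_iff] at hx
      rw [eq_sum_coeff x, Finset.mul_sum]
      refine AddSubgroup.sum_mem _ fun q hq => ?_
      rw [mul_smul_comm, ← hx q (Finsupp.mem_support_iff.1 hq), add_comm]
      exact smul_mem_selfDeg (pathClass_mul_mem_selfDeg p q) _
    · rw [eq_sum_coeff x, Finset.mul_sum]
      refine Finset.sum_eq_zero fun q hq => ?_
      rw [mul_smul_comm, pathClass_mul_eq_zero hright (length_pos_of_mem_gradedRadical hR hx hq),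
        smul_zero]

/-! ### Maps from the radical to the algebra, and depth one -/

open Classical in
/-- The path `p` without its first arrow if that is `b`, and zero otherwise. -/
def stripPath (k : Type w) [Field k] (R : Set Q.Path) (b : E) : Q.Path → Q.BoundAlgebra k R
  | ⟨_, [], _⟩ => 0
  | ⟨_, a :: l, h⟩ => if a = b then Q.pathClass k R ⟨Q.t a, l, h.2⟩ else 0

/-- The linear map that removes the first arrow `b` from the paths that start with `b` and is zero
on all other paths. -/
def strip (k : Type w) [Field k] (R : Set Q.Path) (b : E) :
    Q.BoundAlgebra k R →ₗ[k] Q.BoundAlgebra k R :=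
  Finsupp.linearCombination k (stripPath k R b) ∘ₗ coeff k R

theorem strip_pathClass (b : E) {p : Q.Path} (hp : Q.pathClass k R p ≠ 0) :
    strip k R b (Q.pathClass k R p) = stripPath k R b p := by
  classical
  rw [strip, LinearMap.comp_apply, coeff_pathClass, if_neg hp, Finsupp.linearCombination_single,
    one_smul]

theorem strip_cons (x : V) (b : E) (l : List E) (h : Q.IsWalk x (b :: l))
    (hp : Q.pathClass k R ⟨x, b :: l, h⟩ ≠ 0) :
    strip k R b (Q.pathClass k R ⟨x, b :: l, h⟩) = Q.pathClass k R ⟨Q.t b, l, h.2⟩ :=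
  (strip_pathClass b hp).trans (if_pos rfl)

theorem strip_cons_of_ne (x : V) {a b : E} (hab : a ≠ b) (l : List E) (h : Q.IsWalk x (a :: l)) :
    strip k R b (Q.pathClass k R ⟨x, a :: l, h⟩) = 0 := by
  by_cases hp : Q.pathClass k R ⟨x, a :: l, h⟩ = 0
  · rw [hp, map_zero]
  · exact (strip_pathClass b hp).trans (if_neg hab)

/-- Stripping `b` alone is not right linear, as `b * q` may vanish while `q` does not; multiplying
by a `u` that kills whatever `b` kills repairs this. Positive length is needed because `strip` sends
a stationary path to zero, but not its product with `b`. -/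
theorem mul_strip_mul {b : E} {u : Q.BoundAlgebra k R}
    (hu : ∀ q, Q.arrowClass k R b * Q.pathClass k R q = 0 → u * Q.pathClass k R q = 0)
    {p : Q.Path} (hp : 0 < p.length) (q : Q.Path) :
    u * strip k R b (Q.pathClass k R p * Q.pathClass k R q) =
      u * strip k R b (Q.pathClass k R p) * Q.pathClass k R q := by
  by_cases hp0 : Q.pathClass k R p = 0
  · simp [hp0]
  obtain ⟨x, _ | ⟨a, l⟩, h⟩ := p
  · exact absurd hp (lt_irrefl 0)
  by_cases hab : a = b
  · subst hab
    rw [strip_cons x a l h hp0, mul_assoc]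
    by_cases hq : Q.pathClass k R ⟨x, a :: l, h⟩ * Q.pathClass k R q = 0
    · rw [hq, map_zero, mul_zero]
      by_cases ht : Path.tgt (⟨Q.t a, l, h.2⟩ : Q.Path) = q.src
      · rw [pathClass_mul _ _ ht]
        refine (hu _ ?_).symm
        rw [← pathClass_mul, ← mul_assoc, ← pathClass_cons x a l h, hq]
      · rw [pathClass_mul_of_ne _ _ ht, mul_zero]
    · obtain ⟨ht, hne⟩ := comp_of_mul_ne_zero hq
      rw [pathClass_mul _ _ ht, pathClass_mul ⟨Q.t a, l, h.2⟩ q ht]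
      congr 1
      exact strip_cons x a (l ++ q.arrows) _ hne
  · rw [strip_cons_of_ne x hab, mul_zero, zero_mul]
    by_cases ht : Path.tgt (⟨x, a :: l, h⟩ : Q.Path) = q.src
    · rw [pathClass_mul _ _ ht]
      exact (congrArg (u * ·) (strip_cons_of_ne x hab (l ++ q.arrows) _)).trans (mul_zero u)
    · rw [pathClass_mul_of_ne _ _ ht, map_zero, mul_zero]

/-- The homomorphism of right modules from the radical to `A` that sends the arrow `b` to `u` and
every other arrow to zero. -/
def radicalHom (hR : ∀ p ∈ R, p.length = 2) (b : E) (u : Q.BoundAlgebra k R)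
    (hu : ∀ q, Q.arrowClass k R b * Q.pathClass k R q = 0 → u * Q.pathClass k R q = 0) :
    gradedRadical (Q.grading k R) →ₗ[(Q.BoundAlgebra k R)ᵐᵒᵖ] Q.BoundAlgebra k R where
  toFun x := u * strip k R b x
  map_add' x y := by rw [Submodule.coe_add, map_add, mul_add]
  map_smul' c x := by
    change u * strip k R b ((x : Q.BoundAlgebra k R) * c.unop) = u * strip k R b x * c.unop
    obtain ⟨x, hx⟩ := x
    dsimp only
    rw [eq_sum_coeff x]
    simp only [Finset.sum_mul, map_sum, Finset.mul_sum, smul_mul_assoc, mul_smul_comm, map_smul]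
    refine Finset.sum_congr rfl fun p hp => ?_
    congr 1
    generalize c.unop = y
    induction y using BoundAlgebra.induction with
    | zero => simp
    | add y y' hy hy' => rw [mul_add, map_add, mul_add, hy, hy', mul_add]
    | smul d q =>
      rw [mul_smul_comm, map_smul, mul_smul_comm, mul_smul_comm,
        mul_strip_mul hu (length_pos_of_mem_gradedRadical hR hx hp)]

/-- Removing `b` lowers the degree by one and multiplying by `r` raises it by the length of `r`. The
shift is `-1` for stationary `r`. -/
theorem radicalHom_mem_selfDeg (hR : ∀ p ∈ R, p.length = 2) (b : E) (r : Q.Path)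
    (hu : ∀ q, Q.arrowClass k R b * Q.pathClass k R q = 0 →
      Q.pathClass k R r * Q.pathClass k R q = 0) (i : ℤ) (x : gradedRadical (Q.grading k R))
    (hxi : (x : Q.BoundAlgebra k R) ∈ selfDeg (Q.grading k R) i) :
    radicalHom hR b (Q.pathClass k R r) hu x ∈ selfDeg (Q.grading k R) (i + (r.length - 1)) := by
  change Q.pathClass k R r * strip k R b x ∈ _
  obtain ⟨x, hx⟩ := x
  dsimp only at hxi ⊢
  rw [mem_selfDeg_iff] at hxi
  rw [eq_sum_coeff x, map_sum, Finset.mul_sum]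
  refine AddSubgroup.sum_mem _ fun p hp => ?_
  rw [map_smul, mul_smul_comm]
  refine smul_mem_selfDeg ?_ _
  have hlen := hxi p (Finsupp.mem_support_iff.1 hp)
  have hpos := length_pos_of_mem_gradedRadical hR hx hp
  clear hp
  by_cases hp0 : Q.pathClass k R p = 0
  · rw [hp0, map_zero, mul_zero]; exact AddSubgroup.zero_mem _
  obtain ⟨y, _ | ⟨a, l⟩, h⟩ := p
  · exact absurd hpos (lt_irrefl 0)
  by_cases hab : a = b
  · subst hab
    rw [strip_cons y a l h hp0]
    have := pathClass_mul_mem_selfDeg (k := k) (R := R) r ⟨Q.t a, l, h.2⟩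
    rwa [show i + ((r.length : ℤ) - 1) =
      r.length + (Path.length (⟨Q.t a, l, h.2⟩ : Q.Path) : ℤ) by
        rw [← hlen]; simp only [Path.length, List.length_cons]; push_cast; ring]
  · rw [strip_cons_of_ne y hab, mul_zero]; exact AddSubgroup.zero_mem _

theorem arrowClass_mul_stationary (a : E) :
    Q.arrowClass k R a * Q.pathClass k R (Path.stationary Q (Q.t a)) = Q.arrowClass k R a :=
  pathClass_mul (Path.arrow Q a) _ rfl

theorem strip_arrowClass (hR : ∀ p ∈ R, p.length = 2) (b : E) :
    strip k R b (Q.arrowClass k R b) = Q.pathClass k R (Path.stationary Q (Q.t b)) :=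
  strip_cons (Q.s b) b [] _ (arrowClass_ne_zero hR b)

theorem nontrivial_grExt_one_of_radicalHom (hR : ∀ p ∈ R, p.length = 2) (b : E) (r : Q.Path)
    (hu : ∀ q, Q.arrowClass k R b * Q.pathClass k R q = 0 →
      Q.pathClass k R r * Q.pathClass k R q = 0)
    (hm : ∀ m : Q.BoundAlgebra k R, ∃ a, Q.pathClass k R r * strip k R b (Q.arrowClass k R a) ≠
      m * Q.arrowClass k R a) :
    Nontrivial (grExt (top (Q.grading k R)) (self (Q.grading k R)) 1) := by
  refine nontrivial_grExt_one _ _ (radicalHom hR b _ hu) (radicalHom_mem_selfDeg hR b r hu)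
    fun m => ?_
  obtain ⟨a, ha⟩ := hm m
  exact ⟨⟨_, pathClass_mem_gradedRadical hR (p := Path.arrow Q a) Nat.one_pos⟩, ha⟩

/-- Two arrows with the same source give a nonsplit class. -/
theorem nontrivial_grExt_one_of_ne (hR : ∀ p ∈ R, p.length = 2) {b b' : E} (hne : b ≠ b')
    (hs : Q.s b = Q.s b') :
    Nontrivial (grExt (top (Q.grading k R)) (self (Q.grading k R)) 1) := by
  -- The map fixes `b` and kills `b'`. For a left multiplication by `m`, the coordinates at `b` of
  -- the image of `b` and at `b'` of the image of `b'` would both be that of `m` at the common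
  -- source; here they are `1` and `0`.
  refine nontrivial_grExt_one_of_radicalHom hR b (Path.arrow Q b) (fun q h => h) fun m => ?_
  by_contra! h
  have key : ∀ a, Q.s a = Q.s b →
      coeff k R (m * Q.arrowClass k R a) (Path.arrow Q a) =
        coeff k R m (Path.stationary Q (Q.s b)) := by
    intro a ha
    rw [← ha]
    exact coeff_mul_arrowClass m a (Path.stationary Q (Q.s a)) rfl (arrowClass_ne_zero hR a)
  have h1 := key b rfl
  have h2 := key b' hs.symm
  rw [← h b, strip_arrowClass hR] at h1
  have hstrip : strip k R b (Q.arrowClass k R b') = 0 :=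
    strip_cons_of_ne (Q.s b') (Ne.symm hne) [] _
  rw [← h b', hstrip, mul_zero, map_zero] at h2
  rw [← h2] at h1
  refine one_ne_zero ((coeff_self (arrowClass_ne_zero (k := k) hR b)).symm.trans ?_)
  refine Eq.trans ?_ h1
  exact congrArg (fun z => coeff k R z (Path.arrow Q b)) (arrowClass_mul_stationary b).symm

/-- An arrow with a nonzero prolongation by the only arrow that starts at its target gives a
nonsplit class. -/
theorem nontrivial_grExt_one_of_unique (hR : ∀ p ∈ R, p.length = 2) {a b : E}
    (hab : Follows k R a b) (huniq : ∀ c, Q.s c = Q.t a → c = b) :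
    Nontrivial (grExt (top (Q.grading k R)) (self (Q.grading k R)) 1) := by
  -- The map sends `a` to the stationary path at its target. This is well defined: a nonzero path
  -- from that target is stationary or begins with `b`, and `a * b ≠ 0`, so prolonging it by `a` on
  -- the left keeps it nonzero.
  refine nontrivial_grExt_one_of_radicalHom hR a (Path.stationary Q (Q.t a)) (fun q hq => ?_)
    fun m => ⟨a, fun h => ?_⟩
  · by_contra hne
    obtain ⟨hsrc, -⟩ := comp_of_mul_ne_zero hne
    have hq0 := (pathClass_ne_zero_iff hR q).1 (right_ne_zero_of_mul hne)
    rw [arrowClass, pathClass_mul (Path.arrow Q a) q hsrc] at hq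
    refine (pathClass_ne_zero_iff hR _).2 ?_ hq
    change (a :: q.arrows).IsChain _
    obtain ⟨x, _ | ⟨c, l⟩, hl⟩ := q
    · exact List.isChain_singleton _
    · obtain rfl : c = b := huniq c (hl.1.trans hsrc.symm)
      exact List.isChain_cons_cons.2 ⟨hab, hq0⟩
  -- The product `m * a` has no stationary component, while the prescribed image of `a` has
  -- coefficient one there.
  · have h0 := congrArg (fun z => coeff k R z (Path.stationary Q (Q.t a))) h
    rw [strip_arrowClass hR, coeff_stationary_mul hR, coeff_stationary_mul hR,
      coeff_self (pathClass_stationary_ne_zero hR _), one_mul, arrowClass,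
      coeff_of_ne (p := Path.arrow Q a) (q := Path.stationary Q (Q.t a))
        fun h => List.cons_ne_nil a [] (congrArg Path.arrows h),
      mul_zero] at h0
    exact one_ne_zero h0

theorem IsGentlePresentation.gradedDepth_eq_one [Finite E] (hA : Q.IsGentlePresentation k R)
    (hno : ¬ ∃ p, Q.IsFiniteMaximalPath k R p) : gradedDepth (Q.grading k R) = 1 := by
  have hR := hA.length_two
  refine le_antisymm (iInf₂_le 1 ?_) ?_
  -- Without finite maximal paths every nonzero path can be prolonged: starting at any vertex this
  -- yields `a` and then `b` with `a * b ≠ 0`. The two cases are whether `b` is the only arrow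
  -- leaving the target of `a`.
  · obtain ⟨x⟩ := hA.connected.nonempty
    obtain ⟨a, -⟩ := exists_mul_arrowClass_ne_zero hA hno (pathClass_stationary_ne_zero hR x)
    obtain ⟨b, hb⟩ := exists_mul_arrowClass_ne_zero hA hno (arrowClass_ne_zero hR a)
    by_cases huniq : ∀ c, Q.s c = Q.t a → c = b
    · exact nontrivial_grExt_one_of_unique hR hb huniq
    · push Not at huniq
      obtain ⟨c, hc, hcb⟩ := huniq
      exact nontrivial_grExt_one_of_ne hR hcb (hc.trans (Follows.tgt_eq hb))
  · rw [Order.one_le_iff_pos, pos_iff_ne_zero]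
    exact fun h => hno (hA.gradedDepth_eq_zero_iff.1 h)

end Depth

end ArrowQuiver

end

theorem corollary4p9 {k : Type w} [Field k] {V : Type u} {E : Type v} [Fintype V] [Fintype E]
    (Q : ArrowQuiver V E) (R : Set Q.Path) (hA : Q.IsGentle k R ∨ Q.IsLocallyGentle k R) :
    (gradedDepth (Q.grading k R) = 0 ↔ ∃ p, Q.IsFiniteMaximalPath k R p) ∧
    ((¬ ∃ p, Q.IsFiniteMaximalPath k R p) → gradedDepth (Q.grading k R) = 1) ∧
    (Q.IsLocallyGentle k R ↔ Q.HasInfiniteMaximalPath k R) ∧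
    (Q.IsLocallyGentle k R → HasGKDim k (Q.BoundAlgebra k R) 1) ∧
    (Q.IsGentle k R → HasGKDim k (Q.BoundAlgebra k R) 0) := by
  have h : Q.IsGentlePresentation k R := hA.elim And.left And.left
  have hinf := ArrowQuiver.hasInfiniteMaximalPath_iff (k := k) h.length_two
  exact ⟨h.gradedDepth_eq_zero_iff, h.gradedDepth_eq_one,
    ⟨fun hl => hinf.2 hl.2, fun hp => ⟨h, hinf.1 hp⟩⟩,
    fun hl => h.hasGKDim_one hl.2, fun hg => ArrowQuiver.hasGKDim_zero hg.2⟩
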